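/- Let $L_2(\mathbb{R})$ be the space of complex-valued square integrable functions on $\mathbb{R}$. Define the cardinal B-splines by $N_1=\chi_{[0,1)}$ and $N_{m}(x)=\int_0^1 N_{m-1}(x-t)\,dt$ for $m\ge 2$. For $m\in\mathbb{N}=\{1,2,\dots\}$ and $q\in\mathbb{N}_0$ define the quark $$\varphi_q(x)=\Big(\frac{x}{\lceil m/2\rceil}\Big)^{q}\,N_m\big(x+\lfloor m/2\rfloor\big),$$ and for $p\in\mathbb{N}_0$, $j\in\mathbb{Z}$ let $$V_{p,j}=\overline{\operatorname{span}\{2^{j/2}\varphi_q(2^j\cdot-k):0\le q\le p,\ k\in\mathbb{Z}\}}\subset L_2(\mathbb{R}).$$ A function vector $F=(f_1,\dots,f_n)^T\in L_2(\mathbb{R})^n$ is called $L_2$-stable if there are constants $0<C_1\le C_2<\infty$ such that, for all square summable sequences $(v_k)_{k\in\mathbb{Z}}$ in $\mathbb{C}^n$, the series $\sum_{k}\overline{v}_k^{T}F(\cdot-k)$ converges unconditionally in $L_2(\mathbb{R})$ and $$C_1\sum_k|v_k|^2\le\Big\|\sum_{k}\overline{v}_k^{T}F(\cdot-k)\Big\|_{L_2(\mathbb{R})}^2\le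 C_2\sum_k|v_k|^2 .$$ **Theorem.** Let $m\in\mathbb{N}$ and $p\in\mathbb{N}_0$. The closed subspaces $V_j=V_{p,j}$ of $L_2(\mathbb{R})$ satisfy: (i) $V_j\subset V_{j+1}$ for all $j\in\mathbb{Z}$; (ii) $\overline{\bigcup_{j\in\mathbb{Z}}V_j}=L_2(\mathbb{R})$; (iii) $\bigcap_{j\in\mathbb{Z}}V_j=\{0\}$; (iv) for all $j,k\in\mathbb{Z}$ and $f\in L_2(\mathbb{R})$: $f\in V_j$ if and only if $f(\cdot-2^{-j}k)\in V_j$; (v) for all $j\in\mathbb{Z}$ and $f\in L_2(\mathbb{R})$: $f\in V_j$ if and only if $f(2\,\cdot)\in V_{j+1}$. If moreover $m=1$ or $p=0$, then $(V_{p,j})_{j\in\mathbb{Z}}$ is a multiresolution analysis, that is, in addition to (i)–(v): (vi) for some $r\in\mathbb{N}$ there is an $L_2$-stable vector $G=(g_1,\dots,g_r)^T\in L_2(\mathbb{R})^r$ with $V_0=\overline{\operatorname{span}\{g_l(\cdot-k):1\le l\le r,\ k\in\mathbb{Z}\}}$ (a multiscaling function of multiplicity $r$). More precisely, in this case the quark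 vector $\Phi=(\varphi_0,\dots,\varphi_p)^T$ is such a multiscaling function, of multiplicity $r=p+1$. -/

import Mathlib

open MeasureTheory
open scoped ENNReal ComplexConjugate

noncomputable section

namespace Quark

/-- The complex Hilbert space `L₂(ℝ)` with respect to Lebesgue measure. -/
abbrev L2 : Type := Lp ℂ 2 (volume : Measure ℝ)

/-- The cardinal B-splines: `N₁ = χ_[0,1)` and `N_{m+1}(x) = ∫₀¹ N_m(x - t) dt`.
The index `0` is not used; there the value is set to be zero. -/
def bspline : ℕ → ℝ → ℝ
  | 0 => fun _ => 0
  | 1 => Set.indicator (Set.Ico 0 1) (fun _ => 1)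
  | n + 2 => fun x => ∫ t in (0 : ℝ)..1, bspline (n + 1) (x - t)

/-- The `q`-th cardinal B-spline quark of order `m`:
`φ_q(x) = (x / ⌈m/2⌉)^q * N_m(x + ⌊m/2⌋)`. -/
def quark (m q : ℕ) (x : ℝ) : ℝ :=
  (x / (⌈(m : ℝ) / 2⌉ : ℝ)) ^ q * bspline m (x + (⌊(m : ℝ) / 2⌋ : ℝ))

theorem measurable_bspline (m : ℕ) : Measurable (bspline m) := by
  induction m using bspline.induct with
  | case1 => exact measurable_const
  | case2 => exact measurable_const.indicator measurableSet_Ico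
  | case3 n ih =>
    have h : StronglyMeasurable (Function.uncurry fun x t : ℝ => bspline (n + 1) (x - t)) :=
      (ih.comp (measurable_fst.sub measurable_snd)).stronglyMeasurable
    have := (h.integral_prod_right (ν := volume.restrict (Set.Ioc (0 : ℝ) 1))).measurable
    simpa only [bspline, intervalIntegral.integral_of_le (zero_le_one' ℝ)] using this

theorem norm_bspline_le (m : ℕ) (x : ℝ) : ‖bspline m x‖ ≤ 1 := by
  induction m using bspline.induct generalizing x with
  | case1 => simp [bspline]
  | case2 =>
    by_cases h : x ∈ Set.Ico (0 : ℝ) 1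
    · simp [bspline, Set.indicator_of_mem h]
    · simp [bspline, Set.indicator_of_notMem h]
  | case3 n ih =>
    have := intervalIntegral.norm_integral_le_of_norm_le_const (a := 0) (b := 1)
      (f := fun t => bspline (n + 1) (x - t)) (C := 1) (fun t _ => ih _)
    simpa [bspline] using this

theorem bspline_eq_zero (m : ℕ) (x : ℝ) (hx : x ∉ Set.Icc (0 : ℝ) m) : bspline m x = 0 := by
  induction m using bspline.induct generalizing x with
  | case1 => rfl
  | case2 =>
    refine Set.indicator_of_notMem (fun h => hx ⟨h.1, ?_⟩) _
    simpa using h.2.le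
  | case3 n ih =>
    have h : ∀ t ∈ Set.uIcc (0 : ℝ) 1, bspline (n + 1) (x - t) = 0 := by
      intro t ht
      rw [Set.uIcc_of_le zero_le_one] at ht
      refine ih _ (fun h => hx ⟨?_, ?_⟩)
      · linarith [h.1, ht.1]
      · have := h.2
        push_cast at this ⊢
        linarith [ht.2]
    simp only [bspline]
    rw [intervalIntegral.integral_congr (g := fun _ => (0 : ℝ)) (fun t ht => h t ht)]
    simp

theorem memLp_quark (m q : ℕ) : MemLp (fun x => (quark m q x : ℂ)) 2 volume := by
  set c : ℝ := (⌈(m : ℝ) / 2⌉ : ℝ)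
  set d : ℝ := (⌊(m : ℝ) / 2⌋ : ℝ)
  have hmeas : Measurable (fun x => (quark m q x : ℂ)) := by
    refine Complex.measurable_ofReal.comp ?_
    exact ((measurable_id.div_const c).pow_const q).mul
      ((measurable_bspline m).comp (measurable_id.add_const d))
  obtain ⟨C, hC⟩ := (isCompact_Icc (a := -d) (b := m - d)).exists_bound_of_continuousOn
    (f := fun x : ℝ => (x / c) ^ q) (by fun_prop)
  have hind : (fun x => (quark m q x : ℂ)) =
      (Set.Icc (-d) (m - d)).indicator (fun x => (quark m q x : ℂ)) := by
    refine (Set.indicator_eq_self.2 fun x hx => ?_).symm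
    by_contra h
    refine hx ?_
    have : bspline m (x + d) = 0 := by
      refine bspline_eq_zero m _ fun h' => h ⟨?_, ?_⟩
      · linarith [h'.1]
      · linarith [h'.2]
    simp [quark, d, this]
  rw [hind, memLp_indicator_iff_restrict measurableSet_Icc]
  have : IsFiniteMeasure (volume.restrict (Set.Icc (-d) (m - d))) :=
    ⟨by simp⟩
  refine MemLp.of_bound hmeas.aestronglyMeasurable C ?_
  refine (ae_restrict_iff' measurableSet_Icc).2 (Filter.Eventually.of_forall fun x hx => ?_)
  rw [Complex.norm_real, quark, norm_mul]
  calc _ ≤ ‖(x / c) ^ q‖ * 1 := by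
        gcongr
        exact norm_bspline_le _ _
    _ ≤ C := by simpa using hC x hx

/-- The quark `φ_q` of order `m` as an element of `L₂(ℝ)`. -/
def quarkL2 (m q : ℕ) : L2 := (memLp_quark m q).toLp _

theorem memLp_comp_affine {f : ℝ → ℂ} (hf : MemLp f 2 volume) {a : ℝ} (ha : a ≠ 0) (b : ℝ) :
    MemLp (fun x => f (a * x - b)) 2 volume := by
  have h1 : MemLp (fun x => f (x - b)) 2 volume :=
    hf.comp_measurePreserving (measurePreserving_sub_right volume b)
  have hmap : Measure.map (a * ·) (volume : Measure ℝ) = ENNReal.ofReal |a⁻¹| • volume :=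
    Real.map_volume_mul_left ha
  refine MemLp.comp_of_map (g := fun x => f (x - b)) (f := (a * ·)) ?_
    (measurable_const_mul a).aemeasurable
  rw [hmap]
  exact h1.smul_measure ENNReal.ofReal_ne_top

/-- The function `f(a · - b)` as an element of `L₂(ℝ)`, for `f ∈ L₂(ℝ)` and `a ≠ 0`. -/
def affineComp (a : ℝ) (ha : a ≠ 0) (b : ℝ) (f : L2) : L2 :=
  (memLp_comp_affine (Lp.memLp f) ha b).toLp _

/-- The translate `f(· - b)`. -/
def translate (b : ℝ) (f : L2) : L2 := affineComp 1 one_ne_zero b f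

/-- The dilate `f(2 ·)`. -/
def dilate (f : L2) : L2 := affineComp 2 two_ne_zero 0 f

/-- The vector `Φ = (φ_0, …, φ_p)` of quarks of order `m`. -/
def quarkVector (m p : ℕ) : Fin (p + 1) → L2 := fun q => quarkL2 m q

/-- The space `V_{p,j}`: the closed linear span in `L₂(ℝ)` of the functions
`2^{j/2} φ_q(2^j · - k)` with `0 ≤ q ≤ p` and `k ∈ ℤ`. -/
def quarkSpace (m p : ℕ) (j : ℤ) : Submodule ℂ L2 :=
  (Submodule.span ℂ (Set.range fun i : Fin (p + 1) × ℤ =>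
    (((2 : ℝ) ^ ((j : ℝ) / 2) : ℝ) : ℂ) •
      affineComp ((2 : ℝ) ^ j) (zpow_ne_zero j two_ne_zero) (i.2 : ℝ)
        (quarkVector m p i.1))).topologicalClosure

/-- The closed linear span in `L₂(ℝ)` of the integer translates `g_l(· - k)`. -/
def shiftSpan {r : ℕ} (G : Fin r → L2) : Submodule ℂ L2 :=
  (Submodule.span ℂ (Set.range fun i : Fin r × ℤ =>
    translate (i.2 : ℝ) (G i.1))).topologicalClosure

/-- `L₂`-stability of a function vector `F = (f_1, …, f_n)`. The series
`∑_k conj(v_k)ᵀ F(· - k)` is required to converge (unconditionally) in `L₂(ℝ)` for every square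
summable `v`, and its norm is controlled from below and above by the `ℓ₂`-norm of `v`. -/
def IsL2Stable {n : ℕ} (F : Fin n → L2) : Prop :=
  ∃ C₁ C₂ : ℝ, 0 < C₁ ∧ C₁ ≤ C₂ ∧
    ∀ v : ℤ → Fin n → ℂ, Summable (fun k => ∑ l, ‖v k l‖ ^ 2) →
      Summable (fun k : ℤ => ∑ l, conj (v k l) • translate (k : ℝ) (F l)) ∧
      C₁ * ∑' k, ∑ l, ‖v k l‖ ^ 2
        ≤ ‖∑' k : ℤ, ∑ l, conj (v k l) • translate (k : ℝ) (F l)‖ ^ 2 ∧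
      ‖∑' k : ℤ, ∑ l, conj (v k l) • translate (k : ℝ) (F l)‖ ^ 2
        ≤ C₂ * ∑' k, ∑ l, ‖v k l‖ ^ 2

/-- The properties of a multiresolution analysis other than the existence of a multiscaling
function, for a sequence of closed subspaces. -/
structure HasMRAProperties (V : ℤ → Submodule ℂ L2) : Prop where
  isClosed : ∀ j, IsClosed (V j : Set L2)
  nested : ∀ j, V j ≤ V (j + 1)
  dense : closure (⋃ j, (V j : Set L2)) = Set.univ
  inter : (⋂ j, (V j : Set L2)) = {0}
  shift : ∀ (j k : ℤ) (f : L2), f ∈ V j ↔ translate ((2 : ℝ) ^ (-j) * (k : ℝ)) f ∈ V j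
  dilation : ∀ (j : ℤ) (f : L2), f ∈ V j ↔ dilate f ∈ V (j + 1)

/-- `G` is a multiscaling function of multiplicity `r` for the sequence `V`. -/
def IsMultiscalingFunction (V : ℤ → Submodule ℂ L2) {r : ℕ} (G : Fin r → L2) : Prop :=
  IsL2Stable G ∧ V 0 = shiftSpan G

/-- A multiresolution analysis: the properties above together with the existence of a
multiscaling function of some multiplicity `r ≥ 1`. -/
structure IsMRA (V : ℤ → Submodule ℂ L2) : Prop extends HasMRAProperties V where
  multiscaling : ∃ r : ℕ, 1 ≤ r ∧ ∃ G : Fin r → L2, IsMultiscalingFunction V G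

end Quark

end

/-! Everything rests on the polynomial pieces of `N_m` between consecutive integers. The recursion
for `N_m` becomes one for the pieces (`splinePoly`), and differentiating it yields a partition of
unity and the linear independence of the `m` pieces on `[0, 1)`. Nesting: a B-spline is a
combination of its half-scale translates, and the binomial expansion of the monomial factor produces
quarks of no higher degree (`quark_refinement`). Shift and dilation invariance hold because affine
substitutions permute the generators up to scale and are bounded on `L₂`. Density: already for `q =
0`, the sums `∑ g(k/s) N_m(s · - k)` converge uniformly to continuous compactly supported `g`, by
the partition of unity. Trivial intersection: an element of `V_{-n}` is a polynomial on `[0, 2^n)`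
and on `[-2^n, 0)`. An element of every `V_j` is thus one polynomial on each half-line, and square
integrability forces it to vanish. Stability: `isL2Stable_of_dual` reduces it to functions supported
in `[0, 1)` and biorthogonal to the translates of the generators. Such duals come from inverting a
Gram matrix of polynomials independent on `[0, 1)`: the spline pieces if `p = 0`, the monomials if
`m = 1`. -/

noncomputable section

namespace Quark

/-! ### Polynomial pieces of the B-splines -/

open Polynomial in
/-- The primitive of a real polynomial that vanishes at `0`. -/
def primitive : ℝ[X] →ₗ[ℝ] ℝ[X] :=
  Polynomial.lsum fun n => ((n : ℝ) + 1)⁻¹ • Polynomial.monomial (n + 1)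

theorem primitive_monomial (n : ℕ) (a : ℝ) :
    primitive (Polynomial.monomial n a) = Polynomial.monomial (n + 1) (((n : ℝ) + 1)⁻¹ * a) := by
  simp [primitive, Polynomial.lsum_apply, Polynomial.sum_monomial_index, Polynomial.smul_monomial]

theorem derivative_primitive (p : Polynomial ℝ) : Polynomial.derivative (primitive p) = p := by
  induction p using Polynomial.induction_on' with
  | add p q hp hq => rw [map_add, map_add, hp, hq]
  | monomial n a =>
    rw [primitive_monomial, Polynomial.derivative_monomial]
    congr 1
    have : (n : ℝ) + 1 ≠ 0 := by positivity
    push_cast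
    field_simp

theorem eval_zero_primitive (p : Polynomial ℝ) : (primitive p).eval 0 = 0 := by
  induction p using Polynomial.induction_on' with
  | add p q hp hq => rw [map_add, Polynomial.eval_add, hp, hq, add_zero]
  | monomial n a => simp [primitive_monomial]

theorem natDegree_primitive_le {p : Polynomial ℝ} {n : ℕ} (h : p.natDegree ≤ n) :
    (primitive p).natDegree ≤ n + 1 := by
  rw [primitive, Polynomial.lsum_apply, Polynomial.sum_def]
  refine Polynomial.natDegree_sum_le_of_forall_le _ _ fun i hi => ?_
  have hi' : i ≤ n := (Polynomial.le_natDegree_of_mem_supp i hi).trans h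
  simp only [LinearMap.smul_apply, Polynomial.smul_monomial]
  exact (Polynomial.natDegree_monomial_le _).trans (by omega)

theorem integral_eval (p : Polynomial ℝ) (a b : ℝ) :
    ∫ t in a..b, p.eval t = (primitive p).eval b - (primitive p).eval a := by
  refine intervalIntegral.integral_eq_sub_of_hasDerivAt
    (f := fun x => (primitive p).eval x) (fun x _ => ?_)
    (p.continuous.intervalIntegrable _ _)
  simpa [derivative_primitive] using (primitive p).hasDerivAt x

open Polynomial in
/-- The polynomial that agrees with `N_m(· + i)` on `[0, 1)`. -/
def splinePoly : ℕ → ℤ → ℝ[X]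
  | 0 => fun _ => 0
  | 1 => fun i => if i = 0 then 1 else 0
  | n + 2 => fun i => primitive (splinePoly (n + 1) i) - primitive (splinePoly (n + 1) (i - 1)) +
      C ((primitive (splinePoly (n + 1) (i - 1))).eval 1)

theorem intervalIntegrable_bspline (m : ℕ) (c x a b : ℝ) :
    IntervalIntegrable (fun t => bspline m (x - c * t)) volume a b := by
  refine (intervalIntegrable_const (c := (1 : ℝ))).mono_fun ?_ ?_
  · exact ((measurable_bspline m).comp (by fun_prop)).aestronglyMeasurable
  · exact Filter.Eventually.of_forall fun t => by simpa using norm_bspline_le m _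

/-- Split the defining integral at `t = x`: for `t ≤ x` the argument lies in the piece `i`, for `t >
x` in the piece `i - 1`. This is the source of the recursion for `splinePoly`. -/
theorem bspline_add_int (m : ℕ) (i : ℤ) {x : ℝ} (hx : x ∈ Set.Ico (0 : ℝ) 1) :
    bspline m (x + i) = (splinePoly m i).eval x := by
  induction m using bspline.induct generalizing x i with
  | case1 => simp [bspline, splinePoly]
  | case2 =>
    simp only [bspline, splinePoly]
    by_cases hi : i = 0
    · subst hi
      simp [Set.indicator_of_mem, hx.1, hx.2]
    · rw [if_neg hi, Set.indicator_of_notMem, Polynomial.eval_zero]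
      rintro ⟨h1, h2⟩
      rcases lt_or_gt_of_ne hi with h | h
      · have : (i : ℝ) ≤ -1 := by exact_mod_cast (by omega : i ≤ -1)
        linarith [hx.2]
      · have : (1 : ℝ) ≤ i := by exact_mod_cast (by omega : 1 ≤ i)
        linarith [hx.1]
  | case3 n ih =>
    have hint : ∀ a b, IntervalIntegrable (fun t => bspline (n + 1) (x + i - t)) volume a b := by
      simpa using intervalIntegrable_bspline (n + 1) 1 (x + i)
    have h1 : ∫ t in (0 : ℝ)..x, bspline (n + 1) (x + i - t) =
        ∫ t in (0 : ℝ)..x, (splinePoly (n + 1) i).eval (x - t) := by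
      refine intervalIntegral.integral_congr_ae (Filter.Eventually.of_forall fun t ht => ?_)
      rw [Set.uIoc_of_le hx.1] at ht
      have := ih i (x := x - t) ⟨by linarith [ht.2], by linarith [ht.1, hx.2]⟩
      simp only [← this]
      congr 1
      ring
    have h2 : ∫ t in x..(1 : ℝ), bspline (n + 1) (x + i - t) =
        ∫ t in x..(1 : ℝ), (splinePoly (n + 1) (i - 1)).eval (x + 1 - t) := by
      refine intervalIntegral.integral_congr_ae (Filter.Eventually.of_forall fun t ht => ?_)
      rw [Set.uIoc_of_le hx.2.le] at ht
      have := ih (i - 1) (x := x + 1 - t) ⟨by linarith [ht.2, hx.1], by linarith [ht.1]⟩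
      simp only [← this]
      congr 1
      push_cast
      ring
    simp only [bspline, splinePoly]
    rw [← intervalIntegral.integral_add_adjacent_intervals (hint 0 x) (hint x 1), h1, h2,
      intervalIntegral.integral_comp_sub_left (fun s => (splinePoly (n + 1) i).eval s),
      intervalIntegral.integral_comp_sub_left (fun s => (splinePoly (n + 1) (i - 1)).eval s),
      integral_eval, integral_eval]
    simp [eval_zero_primitive]
    ring

theorem splinePoly_eq_zero (m : ℕ) (i : ℤ) (hi : i < 0 ∨ (m : ℤ) ≤ i) : splinePoly m i = 0 := by
  induction m using bspline.induct generalizing i with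
  | case1 => rfl
  | case2 => exact if_neg (by push_cast at hi; omega)
  | case3 n ih =>
    push_cast at hi
    simp [splinePoly, ih i (by push_cast; omega), ih (i - 1) (by push_cast; omega)]

theorem natDegree_splinePoly_le (m : ℕ) (i : ℤ) : (splinePoly m i).natDegree ≤ m := by
  induction m using bspline.induct generalizing i with
  | case1 => simp [splinePoly]
  | case2 => by_cases hi : i = 0 <;> simp [splinePoly, hi]
  | case3 n ih =>
    have := natDegree_primitive_le (ih i)
    have := natDegree_primitive_le (ih (i - 1))
    simp only [splinePoly]
    refine Polynomial.natDegree_add_le_of_degree_le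
      ((Polynomial.natDegree_sub_le _ _).trans (by simp; omega)) (by simp)

theorem derivative_splinePoly (n : ℕ) (i : ℤ) :
    Polynomial.derivative (splinePoly (n + 2) i) =
      splinePoly (n + 1) i - splinePoly (n + 1) (i - 1) := by
  simp [splinePoly, derivative_primitive]

/-- Partition of unity on `[0, 1)`: the primitives telescope, and the remaining constants add up to
the integral over `[0, 1]` of the previous sum, which is `1`. -/
theorem sum_splinePoly (n : ℕ) :
    ∑ i ∈ Finset.range (n + 1), splinePoly (n + 1) (i : ℤ) = 1 := by
  induction n with
  | zero => simp [splinePoly]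
  | succ n ih =>
    have h1 : (primitive 1).eval 1 = 1 := by
      simpa [eval_zero_primitive] using (integral_eval 1 0 1).symm
    simp only [splinePoly]
    rw [Finset.sum_add_distrib, Finset.sum_sub_distrib,
      Finset.sum_range_succ (fun i : ℕ => primitive (splinePoly (n + 1) i)),
      Finset.sum_range_succ' (fun i : ℕ => primitive (splinePoly (n + 1) ((i : ℤ) - 1))),
      Finset.sum_range_succ' (fun i : ℕ =>
        Polynomial.C ((primitive (splinePoly (n + 1) ((i : ℤ) - 1))).eval 1)),
      splinePoly_eq_zero (n + 1) ((n + 1 : ℕ) : ℤ) (Or.inr le_rfl)]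
    simp only [Nat.cast_zero, zero_sub, splinePoly_eq_zero (n + 1) (-1) (by omega), Nat.cast_add,
      Nat.cast_one, add_sub_cancel_right, map_zero, Polynomial.eval_zero, add_zero, sub_self,
      zero_add]
    rw [← map_sum, ← Polynomial.eval_finsetSum, ← map_sum, ih, h1, map_one]

/-- Differentiating a relation with coefficients `a i` gives a relation of lower order with
coefficients `a i - a (i + 1)`. By induction all `a i` are equal, and the partition of unity makes
their common value zero. -/
theorem splinePoly_linearIndependent (n : ℕ) (a : ℕ → ℝ)
    (h : ∑ i ∈ Finset.range (n + 1), a i • splinePoly (n + 1) (i : ℤ) = 0) :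
    ∀ i < n + 1, a i = 0 := by
  induction n generalizing a with
  | zero =>
    intro i hi
    obtain rfl : i = 0 := by omega
    simpa [splinePoly] using h
  | succ n ih =>
    have h' := congrArg Polynomial.derivative h
    simp only [Polynomial.derivative_sum, Polynomial.derivative_smul, derivative_splinePoly,
      smul_sub, Finset.sum_sub_distrib, map_zero] at h'
    rw [Finset.sum_range_succ,
      Finset.sum_range_succ' (fun i : ℕ => a i • splinePoly (n + 1) ((i : ℤ) - 1)),
      splinePoly_eq_zero (n + 1) ((n + 1 : ℕ) : ℤ) (Or.inr le_rfl)] at h'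
    simp only [Nat.cast_zero, zero_sub, splinePoly_eq_zero (n + 1) (-1) (by omega), Nat.cast_add,
      Nat.cast_one, add_sub_cancel_right, smul_zero, add_zero] at h'
    rw [← Finset.sum_sub_distrib] at h'
    simp only [← sub_smul] at h'
    have hd := ih (fun i => a i - a (i + 1)) h'
    have hc : ∀ i < n + 2, a i = a 0 := by
      intro i
      induction i with
      | zero => simp
      | succ i ihi =>
        intro hi
        rw [← ihi (by omega)]
        linarith [hd i (by omega)]
    have h0 : a 0 = 0 := by
      rw [Finset.sum_congr rfl (g := fun i : ℕ => a 0 • splinePoly (n + 1 + 1) (i : ℤ))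
        (fun i hi => by rw [hc i (Finset.mem_range.1 hi)]), ← Finset.smul_sum,
        sum_splinePoly] at h
      simpa using h
    intro i hi
    rw [hc i hi, h0]

/-! ### Partition of unity and two-scale relation -/

theorem bspline_nonneg (m : ℕ) (x : ℝ) : 0 ≤ bspline m x := by
  induction m using bspline.induct generalizing x with
  | case1 => exact le_rfl
  | case2 => exact Set.indicator_nonneg (fun _ _ => zero_le_one) _
  | case3 n ih => exact intervalIntegral.integral_nonneg zero_le_one fun t _ => ih _

/-- The `k`-th term is the piece `⌊y⌋ - k` evaluated at the fractional part of `y`, so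
`sum_splinePoly` applies after reindexing. A finite set containing the support avoids infinite sums.
-/
theorem sum_bspline_sub_int {m : ℕ} (hm : 1 ≤ m) (y : ℝ) (S : Finset ℤ)
    (hS : ∀ k : ℤ, bspline m (y - k) ≠ 0 → k ∈ S) : ∑ k ∈ S, bspline m (y - k) = 1 := by
  obtain ⟨n, rfl⟩ : ∃ n, m = n + 1 := ⟨m - 1, by omega⟩
  have hy : ∀ k : ℤ, bspline (n + 1) (y - k) =
      (splinePoly (n + 1) (Equiv.subLeft ⌊y⌋ k)).eval (Int.fract y) := by
    intro k
    rw [← bspline_add_int _ _ ⟨Int.fract_nonneg y, Int.fract_lt_one y⟩]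
    congr 1
    simp only [Equiv.subLeft_apply, Int.cast_sub, Int.fract]
    ring
  rw [← finsum_eq_sum_of_support_subset (fun k : ℤ => bspline (n + 1) (y - k))
    (fun k hk => hS k hk)]
  simp only [hy]
  rw [finsum_comp_equiv (Equiv.subLeft ⌊y⌋)
    (f := fun i => (splinePoly (n + 1) i).eval (Int.fract y)),
    finsum_eq_sum_of_support_subset (s := (Finset.range (n + 1)).map Nat.castEmbedding)]
  · rw [Finset.sum_map]
    simp only [Nat.castEmbedding_apply]
    rw [← Polynomial.eval_finsetSum, sum_splinePoly, Polynomial.eval_one]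
  · intro i hi
    by_contra h
    refine hi ?_
    dsimp only
    rw [splinePoly_eq_zero, Polynomial.eval_zero]
    by_contra h'
    push Not at h'
    refine h ?_
    simp only [Finset.coe_map, Nat.castEmbedding_apply, Set.mem_image, Finset.coe_range, Set.mem_Iio]
    exact ⟨i.toNat, by omega, by omega⟩

theorem sum_choose_mul_add (n : ℕ) (f : ℕ → ℝ) :
    ∑ k ∈ Finset.range (n + 1), (n.choose k : ℝ) * (f k + f (k + 1)) =
      ∑ k ∈ Finset.range (n + 2), ((n + 1).choose k : ℝ) * f k := by
  rw [Finset.sum_range_succ' _ (n + 1)]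
  simp only [Nat.choose_succ_succ, Nat.cast_add, add_mul, mul_add, Finset.sum_add_distrib,
    Nat.choose_zero_right]
  have := Finset.sum_range_succ (fun k => (n.choose k : ℝ) * f k) (n + 1)
  rw [Finset.sum_range_succ'] at this
  simp only [Nat.choose_succ_self, Nat.cast_zero, zero_mul, add_zero, Nat.choose_zero_right] at this
  rw [← this]
  ring

/-- Integrating the relation of order `n + 1` turns each `N_{n+1}(y - 2t)` into half the sum of two
adjacent translates of `N_{n+2}` (`key`); Pascal's rule then updates the binomial coefficients. -/
theorem bspline_refinement {m : ℕ} (hm : 1 ≤ m) (x : ℝ) :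
    bspline m x = 2 / 2 ^ m *
      ∑ k ∈ Finset.range (m + 1), (m.choose k : ℝ) * bspline m (2 * x - k) := by
  induction m using bspline.induct generalizing x with
  | case1 => omega
  | case2 =>
    simp only [bspline, Finset.sum_range_succ, Set.indicator, Set.mem_Ico]
    norm_num
    split_ifs <;> grind
  | case3 n ih =>
    have key : ∀ y : ℝ, ∫ t in (0 : ℝ)..1, bspline (n + 1) (y - 2 * t) =
        2⁻¹ * (bspline (n + 2) y + bspline (n + 2) (y - 1)) := by
      intro y
      have hint : ∀ a b, IntervalIntegrable (fun t => bspline (n + 1) (y - t)) volume a b := by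
        simpa using intervalIntegrable_bspline (n + 1) 1 y
      have h1 := intervalIntegral.integral_comp_mul_left
        (fun s => bspline (n + 1) (y - s)) (a := 0) (b := 1) (two_ne_zero (α := ℝ))
      have h2 := intervalIntegral.integral_comp_add_right
        (fun s => bspline (n + 1) (y - s)) (a := 0) (b := 1) 1
      rw [h1, mul_zero, mul_one,
        ← intervalIntegral.integral_add_adjacent_intervals (hint 0 1) (hint 1 2), smul_eq_mul]
      simp only [bspline]
      congr 2
      rw [zero_add, one_add_one_eq_two] at h2
      rw [← h2]
      simp only [sub_sub, add_comm]
    have h3 : bspline (n + 2) x = ∫ t in (0 : ℝ)..1, 2 / 2 ^ (n + 1) *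
        ∑ k ∈ Finset.range (n + 1 + 1),
          ((n + 1).choose k : ℝ) * bspline (n + 1) ((2 * x - k) - 2 * t) := by
      simp only [bspline]
      congr 1
      ext t
      rw [ih (by omega)]
      congr! 4
      ring
    rw [h3, intervalIntegral.integral_const_mul, intervalIntegral.integral_finsetSum
      (fun k _ => (intervalIntegrable_bspline _ _ _ _ _).const_mul _)]
    simp only [intervalIntegral.integral_const_mul, key]
    rw [← sum_choose_mul_add (n + 1) (fun k => bspline (n + 2) (2 * x - k)), pow_succ _ (n + 1),
      Finset.mul_sum, Finset.mul_sum]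
    refine Finset.sum_congr rfl fun k _ => ?_
    push_cast
    rw [sub_sub]
    field_simp

/-! ### Affine substitutions on `L₂(ℝ)` -/

theorem map_affine_volume {a : ℝ} (ha : a ≠ 0) (b : ℝ) :
    Measure.map (fun x => a * x - b) (volume : Measure ℝ) = ENNReal.ofReal |a⁻¹| • volume := by
  have h := Measure.map_map (μ := (volume : Measure ℝ)) (measurable_sub_const b)
    (measurable_const_mul a)
  rw [Real.map_volume_mul_left ha, Measure.map_smul, map_sub_right_eq_self] at h
  exact h.symm

theorem ae_comp_affine {P : ℝ → Prop} (h : ∀ᵐ x, P x) {a : ℝ} (ha : a ≠ 0) (b : ℝ) :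
    ∀ᵐ x, P (a * x - b) := by
  have hq : Measure.QuasiMeasurePreserving (fun x : ℝ => a * x - b) volume volume :=
    ⟨by fun_prop, by
      rw [map_affine_volume ha b]
      exact Measure.smul_absolutelyContinuous⟩
  exact hq.ae h

theorem affineComp_coeFn (a : ℝ) (ha : a ≠ 0) (b : ℝ) (f : L2) :
    affineComp a ha b f =ᵐ[volume] fun x => f (a * x - b) :=
  MemLp.coeFn_toLp _

theorem affineComp_toLp {a : ℝ} (ha : a ≠ 0) (b : ℝ) {f : ℝ → ℂ} (hf : MemLp f 2 volume) :
    affineComp a ha b (hf.toLp f) = (memLp_comp_affine hf ha b).toLp _ := by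
  refine (MemLp.toLp_eq_toLp_iff _ _).2 ?_
  exact ae_comp_affine hf.coeFn_toLp ha b

theorem norm_affineComp (a : ℝ) (ha : a ≠ 0) (b : ℝ) (f : L2) :
    ‖affineComp a ha b f‖ = |a⁻¹| ^ (1 / 2 : ℝ) * ‖f‖ := by
  have hf : AEStronglyMeasurable f (Measure.map (fun x => a * x - b) volume) := by
    rw [map_affine_volume ha b]
    exact (Lp.aestronglyMeasurable f).smul_measure _
  have h := eLpNorm_map_measure (p := 2) hf (by fun_prop)
  rw [map_affine_volume ha b, eLpNorm_smul_measure_of_ne_top (by simp)] at h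
  rw [affineComp, Lp.norm_toLp]
  change (eLpNorm (f ∘ fun x => a * x - b) 2 volume).toReal = _
  rw [← h, smul_eq_mul, ENNReal.toReal_mul, ENNReal.ofReal_rpow_of_nonneg (abs_nonneg _) (by simp),
    ENNReal.toReal_ofReal (by positivity), Lp.norm_def]
  simp

/-- `affineComp` as a continuous linear map. -/
def affineCLM (a : ℝ) (ha : a ≠ 0) (b : ℝ) : L2 →L[ℂ] L2 :=
  LinearMap.mkContinuous
    { toFun := affineComp a ha b
      map_add' := fun f g => by
        rw [affineComp, affineComp, affineComp, ← MemLp.toLp_add]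
        refine (MemLp.toLp_eq_toLp_iff _ _).2 ?_
        exact ae_comp_affine (Lp.coeFn_add f g) ha b
      map_smul' := fun c f => by
        rw [affineComp, affineComp, RingHom.id_apply, ← MemLp.toLp_const_smul]
        refine (MemLp.toLp_eq_toLp_iff _ _).2 ?_
        exact ae_comp_affine (Lp.coeFn_smul c f) ha b }
    (|a⁻¹| ^ (1 / 2 : ℝ)) (fun f => (norm_affineComp a ha b f).le)

theorem affineComp_affineComp {a a' a'' : ℝ} (ha : a ≠ 0) (ha' : a' ≠ 0) (ha'' : a'' ≠ 0)
    (b b' b'' : ℝ) (h : a'' = a' * a) (h' : b'' = a' * b + b') (f : L2) :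
    affineComp a ha b (affineComp a' ha' b' f) = affineComp a'' ha'' b'' f := by
  subst h h'
  conv_lhs => rw [affineComp.eq_def a' ha' b' f]
  rw [affineComp_toLp, affineComp]
  congr 1
  ext x
  congr 1
  ring

theorem affineComp_one_zero (f : L2) : affineComp 1 one_ne_zero 0 f = f := by
  apply Lp.ext
  filter_upwards [affineComp_coeFn 1 one_ne_zero 0 f] with x hx
  simpa using hx

theorem affineComp_congr {a a' b b' : ℝ} (ha : a ≠ 0) (ha' : a' ≠ 0) (h : a = a') (h' : b = b')
    (f : L2) : affineComp a ha b f = affineComp a' ha' b' f := by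
  subst h h'
  rfl

/-! ### Generators, shift invariance and dilation -/

/-- The unnormalised generator `φ_q(2^j · - k)` of `V_{p,j}`. -/
def generator (m q : ℕ) (j k : ℤ) : L2 :=
  affineComp ((2 : ℝ) ^ j) (zpow_ne_zero j two_ne_zero) (k : ℝ) (quarkL2 m q)

theorem generator_coeFn (m q : ℕ) (j k : ℤ) :
    generator m q j k =ᵐ[volume] fun x => (quark m q ((2 : ℝ) ^ j * x - k) : ℂ) := by
  rw [generator, quarkL2, affineComp_toLp]
  exact MemLp.coeFn_toLp _

theorem generator_mem (m p : ℕ) {q : ℕ} (hq : q ≤ p) (j k : ℤ) :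
    generator m q j k ∈ quarkSpace m p j := by
  refine Submodule.le_topologicalClosure _ ?_
  have hc : (((2 : ℝ) ^ ((j : ℝ) / 2) : ℝ) : ℂ) ≠ 0 := by
    exact_mod_cast (Real.rpow_pos_of_pos two_pos _).ne'
  have := Submodule.smul_mem _ (((2 : ℝ) ^ ((j : ℝ) / 2) : ℝ) : ℂ)⁻¹
    (Submodule.subset_span (R := ℂ) (Set.mem_range_self
      (f := fun i : Fin (p + 1) × ℤ => (((2 : ℝ) ^ ((j : ℝ) / 2) : ℝ) : ℂ) •
      affineComp ((2 : ℝ) ^ j) (zpow_ne_zero j two_ne_zero) (i.2 : ℝ)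
        (quarkVector m p i.1)) (⟨q, Nat.lt_succ_of_le hq⟩, k)))
  rw [smul_smul, inv_mul_cancel₀ hc, one_smul] at this
  exact this

theorem isClosed_quarkSpace (m p : ℕ) (j : ℤ) : IsClosed (quarkSpace m p j : Set L2) :=
  Submodule.isClosed_topologicalClosure _

theorem quarkSpace_le {m p : ℕ} {j : ℤ} {V : Submodule ℂ L2} (hV : IsClosed (V : Set L2))
    (h : ∀ q ≤ p, ∀ k, generator m q j k ∈ V) : quarkSpace m p j ≤ V := by
  refine Submodule.topologicalClosure_minimal _ (Submodule.span_le.2 ?_) hV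
  rintro _ ⟨⟨q, k⟩, rfl⟩
  exact V.smul_mem _ (h q (Nat.le_of_lt_succ q.2) k)

theorem quarkSpace_map_mem {m p : ℕ} {j : ℤ} {V : Submodule ℂ L2} (hV : IsClosed (V : Set L2))
    (T : L2 →L[ℂ] L2) (h : ∀ q ≤ p, ∀ k, T (generator m q j k) ∈ V) {f : L2}
    (hf : f ∈ quarkSpace m p j) : T f ∈ V :=
  quarkSpace_le (V := V.comap (T : L2 →ₗ[ℂ] L2)) (hV.preimage T.continuous) h hf

/-- The two equations say that `x ↦ a x - b` takes the generator with indices `j, k` to the one with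
indices `j', l + k`. Translation, dilation and their inverses are all instances. -/
theorem affineComp_generator {m p : ℕ} {a : ℝ} (ha : a ≠ 0) (b : ℝ) {j j' l : ℤ}
    (hj : (2 : ℝ) ^ j * a = 2 ^ j') (hl : (2 : ℝ) ^ j * b = l) {f : L2}
    (hf : f ∈ quarkSpace m p j) : affineComp a ha b f ∈ quarkSpace m p j' := by
  refine quarkSpace_map_mem (isClosed_quarkSpace m p j') (affineCLM a ha b) (fun q hq k => ?_) hf
  have : affineCLM a ha b (generator m q j k) = generator m q j' (l + k) := by
    refine affineComp_affineComp ha _ _ _ _ _ hj.symm ?_ _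
    rw [hl]
    push_cast
    rfl
  rw [this]
  exact generator_mem m p hq _ _

theorem translate_mem_iff (m p : ℕ) (j k : ℤ) (f : L2) :
    f ∈ quarkSpace m p j ↔ translate ((2 : ℝ) ^ (-j) * (k : ℝ)) f ∈ quarkSpace m p j := by
  have h2 : (2 : ℝ) ^ j * 2 ^ (-j) = 1 := by
    rw [← zpow_add₀ two_ne_zero, add_neg_cancel, zpow_zero]
  constructor
  · exact affineComp_generator one_ne_zero _ (mul_one _) (l := k) (by rw [← mul_assoc, h2, one_mul])
  · intro h
    have := affineComp_generator one_ne_zero (-((2 : ℝ) ^ (-j) * (k : ℝ))) (mul_one _) (l := -k)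
      (by rw [mul_neg, ← mul_assoc, h2, one_mul, Int.cast_neg]) h
    rwa [translate, affineComp_affineComp _ _ one_ne_zero _ _ 0 (by simp) (by simp),
      affineComp_one_zero] at this

theorem dilate_mem_iff (m p : ℕ) (j : ℤ) (f : L2) :
    f ∈ quarkSpace m p j ↔ dilate f ∈ quarkSpace m p (j + 1) := by
  constructor
  · exact affineComp_generator two_ne_zero _ (zpow_add_one₀ two_ne_zero j).symm (l := 0) (by simp)
  · intro h
    have := affineComp_generator (inv_ne_zero two_ne_zero) 0 (j' := j) (l := 0)
      (by rw [zpow_add_one₀ two_ne_zero, mul_assoc, mul_inv_cancel₀ two_ne_zero, mul_one])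
      (by simp) h
    rwa [dilate, affineComp_affineComp _ _ one_ne_zero _ _ 0 (by simp) (by simp),
      affineComp_one_zero] at this

/-! ### Nesting -/

theorem half_ceil_pos {m : ℕ} (hm : 1 ≤ m) : (0 : ℝ) < (⌈(m : ℝ) / 2⌉ : ℝ) := by
  have : (0 : ℝ) < m := by exact_mod_cast hm
  exact_mod_cast Int.ceil_pos.2 (by positivity)

/-- In the `k`-th term of the two-scale relation, write `x` as half of `(2x - (k - d)) + (k - d)`
with `d = ⌊m/2⌋` and expand the `q`-th power. Only quarks of index `i ≤ q` appear, so `p` need not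
grow. -/
theorem quark_refinement {m : ℕ} (hm : 1 ≤ m) (q : ℕ) : ∃ α : ℕ → ℕ → ℝ, ∀ x,
    quark m q x = ∑ k ∈ Finset.range (m + 1), ∑ i ∈ Finset.range (q + 1),
      α k i * quark m i (2 * x - ((k : ℤ) - ⌊(m : ℝ) / 2⌋ : ℤ)) := by
  have hc := half_ceil_pos hm
  refine ⟨fun k i => 2 / 2 ^ m * m.choose k * ((1 / 2) ^ q *
    ((k - (⌊(m : ℝ) / 2⌋ : ℝ)) / (⌈(m : ℝ) / 2⌉ : ℝ)) ^ (q - i) * q.choose i), fun x => ?_⟩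
  rw [quark, bspline_refinement hm, Finset.mul_sum, Finset.mul_sum]
  refine Finset.sum_congr rfl fun k _ => ?_
  set d : ℝ := (⌊(m : ℝ) / 2⌋ : ℝ)
  set c : ℝ := (⌈(m : ℝ) / 2⌉ : ℝ)
  have hN : 2 * x - ((((k : ℤ) - ⌊(m : ℝ) / 2⌋ : ℤ)) : ℝ) + d = 2 * (x + d) - k := by
    push_cast
    ring
  have hp : (x / c) ^ q = (1 / 2) ^ q * ∑ i ∈ Finset.range (q + 1),
      ((2 * x - (k - d)) / c) ^ i * ((k - d) / c) ^ (q - i) * q.choose i := by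
    rw [← add_pow, ← mul_pow]
    congr 1
    field_simp
    ring
  simp only [quark]
  rw [hN, hp, Finset.mul_sum, Finset.sum_mul]
  refine Finset.sum_congr rfl fun i _ => ?_
  push_cast
  ring

theorem coeFn_sum_smul_generator {ι : Type*} (s : Finset ι) (c : ι → ℂ) (m : ℕ) (q : ι → ℕ)
    (j : ℤ) (k : ι → ℤ) : (∑ i ∈ s, c i • generator m (q i) j (k i) : L2) =ᵐ[volume]
      fun x => ∑ i ∈ s, c i * (quark m (q i) ((2 : ℝ) ^ j * x - k i) : ℂ) := by
  have h : ∀ᵐ x, ∀ i ∈ s, (c i • generator m (q i) j (k i) : L2) x =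
      c i * (quark m (q i) ((2 : ℝ) ^ j * x - k i) : ℂ) := by
    rw [Filter.eventually_all_finset]
    intro i _
    filter_upwards [Lp.coeFn_smul (c i) (generator m (q i) j (k i)),
      generator_coeFn m (q i) j (k i)] with x h1 h2
    rw [h1, Pi.smul_apply, h2, smul_eq_mul]
  filter_upwards [Lp.coeFn_fun_finsetSum s fun i => c i • generator m (q i) j (k i), h] with x h1 h2
  rw [h1]
  exact Finset.sum_congr rfl h2

theorem generator_mem_succ {m : ℕ} (hm : 1 ≤ m) {p q : ℕ} (hq : q ≤ p) (j k : ℤ) :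
    generator m q j k ∈ quarkSpace m p (j + 1) := by
  obtain ⟨α, hα⟩ := quark_refinement hm q
  have : generator m q j k = ∑ i ∈ Finset.range (m + 1) ×ˢ Finset.range (q + 1),
      (α i.1 i.2 : ℂ) • generator m i.2 (j + 1) (2 * k + ((i.1 : ℤ) - ⌊(m : ℝ) / 2⌋)) := by
    apply Lp.ext
    filter_upwards [generator_coeFn m q j k, coeFn_sum_smul_generator
      (Finset.range (m + 1) ×ˢ Finset.range (q + 1)) (fun i => (α i.1 i.2 : ℂ)) m Prod.snd (j + 1)
      (fun i => 2 * k + ((i.1 : ℤ) - ⌊(m : ℝ) / 2⌋))] with x h1 h2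
    rw [h1, h2, hα, ← Finset.sum_product', Complex.ofReal_sum]
    refine Finset.sum_congr rfl fun i _ => ?_
    rw [Complex.ofReal_mul]
    congr 3
    rw [zpow_add_one₀ two_ne_zero]
    push_cast
    ring
  rw [this]
  refine Submodule.sum_mem _ fun i hi => Submodule.smul_mem _ _ (generator_mem m p ?_ _ _)
  exact (Nat.le_of_lt_succ (Finset.mem_range.1 (Finset.mem_product.1 hi).2)).trans hq

theorem quarkSpace_le_succ {m : ℕ} (hm : 1 ≤ m) (p : ℕ) (j : ℤ) :
    quarkSpace m p j ≤ quarkSpace m p (j + 1) :=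
  quarkSpace_le (isClosed_quarkSpace m p (j + 1)) fun _ hq k => generator_mem_succ hm hq j k

/-! ### Density of the union -/

/-- The spline `∑_{|k| ≤ K} g(k / s) N_m(s · - k)`. -/
def quasiInterpolant (m : ℕ) (g : ℝ → ℂ) (s : ℝ) (K : ℤ) (x : ℝ) : ℂ :=
  ∑ k ∈ Finset.Icc (-K) K, g (k / s) * (bspline m (s * x - k) : ℂ)

theorem bspline_ne_zero {m : ℕ} {y : ℝ} (h : bspline m y ≠ 0) : 0 ≤ y ∧ y ≤ m := by
  by_contra h'
  exact h (bspline_eq_zero m y h')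

theorem abs_sub_div_le {m : ℕ} {s x : ℝ} (hs : 1 ≤ s) {k : ℤ} (h : bspline m (s * x - k) ≠ 0) :
    |x - k / s| ≤ m / s := by
  have hs' : 0 < s := by linarith
  obtain ⟨h0, h1⟩ := bspline_ne_zero h
  have : x - k / s = (s * x - k) / s := by field_simp
  rw [this, abs_of_nonneg (by positivity)]
  gcongr

theorem quasiInterpolant_eq_zero {m : ℕ} {g : ℝ → ℂ} {s R : ℝ} (hs : 1 ≤ s)
    (hg : ∀ x, R < |x| → g x = 0) (K : ℤ) {x : ℝ} (hx : R + m < |x|) :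
    quasiInterpolant m g s K x = 0 := by
  refine Finset.sum_eq_zero fun k _ => ?_
  by_cases h : bspline m (s * x - k) = 0
  · simp [h]
  · have h1 := abs_sub_div_le hs h
    have h2 : (m : ℝ) / s ≤ m := div_le_self (by positivity) hs
    have h3 := abs_sub_abs_le_abs_sub x (k / s)
    rw [hg (k / s) (by linarith), zero_mul]

/-- By the partition of unity the error is an average of the differences `g x - g (k / s)`, with
weights vanishing unless `|x - k / s| ≤ m / s`. The bound on `K` ensures that no nonzero weight is
cut off while `|x| ≤ R + m`; beyond that both functions vanish. -/
theorem dist_quasiInterpolant_le {m : ℕ} (hm : 1 ≤ m) {g : ℝ → ℂ} {s R c : ℝ} (hs : 1 ≤ s)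
    (hg : ∀ x, R < |x| → g x = 0) (hc : 0 ≤ c) (hgc : ∀ x y, |x - y| ≤ m / s → ‖g x - g y‖ ≤ c)
    {K : ℤ} (hK : s * (R + m) + m ≤ K) (x : ℝ) : dist (g x) (quasiInterpolant m g s K x) ≤ c := by
  rcases le_or_gt |x| (R + m) with hx | hx
  · have hsum : ∑ k ∈ Finset.Icc (-K) K, bspline m (s * x - k) = 1 := by
      refine sum_bspline_sub_int hm _ _ fun k hk => ?_
      obtain ⟨h0, h1⟩ := bspline_ne_zero hk
      obtain ⟨h2, h3⟩ := abs_le.1 hx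
      have hm' : (0 : ℝ) ≤ m := by positivity
      have h4 : s * x ≤ s * (R + m) := by gcongr
      have h5 : s * (-(R + m)) ≤ s * x := by gcongr
      rw [Finset.mem_Icc]
      constructor
      · have : ((-K : ℤ) : ℝ) ≤ k := by push_cast; linarith
        exact_mod_cast this
      · have : (k : ℝ) ≤ K := by linarith
        exact_mod_cast this
    have h1 : g x = ∑ k ∈ Finset.Icc (-K) K, g x * (bspline m (s * x - k) : ℂ) := by
      rw [← Finset.mul_sum, ← Complex.ofReal_sum, hsum, Complex.ofReal_one, mul_one]
    rw [dist_eq_norm, h1, quasiInterpolant, ← Finset.sum_sub_distrib]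
    calc _ ≤ ∑ k ∈ Finset.Icc (-K) K, c * bspline m (s * x - k) := by
          refine norm_sum_le_of_le _ fun k _ => ?_
          by_cases h : bspline m (s * x - k) = 0
          · simp [h]
          · rw [← sub_mul, norm_mul, Complex.norm_real, Real.norm_of_nonneg (bspline_nonneg _ _)]
            exact mul_le_mul_of_nonneg_right (hgc _ _ (abs_sub_div_le hs h)) (bspline_nonneg _ _)
      _ = c := by rw [← Finset.mul_sum, hsum, mul_one]
  · rw [quasiInterpolant_eq_zero hs hg K hx, hg x (lt_of_le_of_lt (by simp) hx), dist_self]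
    exact hc

theorem exists_mem_quarkSpace_coeFn (m p : ℕ) (g : ℝ → ℂ) (j K : ℤ) :
    ∃ h ∈ quarkSpace m p j, h =ᵐ[volume] quasiInterpolant m g ((2 : ℝ) ^ j) K := by
  -- Only `q = 0` is needed; the extra shift cancels the centring in the definition of the quark.
  refine ⟨∑ k ∈ Finset.Icc (-K) K, g (k / 2 ^ j) • generator m 0 j (k + ⌊(m : ℝ) / 2⌋),
    Submodule.sum_mem _ fun k _ => Submodule.smul_mem _ _ (generator_mem m p (Nat.zero_le p) _ _),
    ?_⟩
  refine (coeFn_sum_smul_generator _ (fun k : ℤ => g (k / 2 ^ j)) m (fun _ => 0) j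
    (fun k => k + ⌊(m : ℝ) / 2⌋)).trans (Filter.Eventually.of_forall fun x => ?_)
  refine Finset.sum_congr rfl fun k _ => ?_
  simp only [quark, pow_zero, one_mul]
  congr 3
  push_cast
  ring

theorem dense_iUnion_quarkSpace {m : ℕ} (hm : 1 ≤ m) (p : ℕ) :
    closure (⋃ j, (quarkSpace m p j : Set L2)) = Set.univ := by
  refine Set.eq_univ_of_forall fun f => Metric.mem_closure_iff.2 fun ε hε => ?_
  obtain ⟨g, hg_supp, hfg, hg_cont, hg⟩ := (Lp.memLp f).exists_hasCompactSupport_eLpNorm_sub_le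
    (by simp) (ε := ENNReal.ofReal (ε / 2)) (by simpa using hε)
  obtain ⟨R, hR⟩ : ∃ R, ∀ x, R < |x| → g x = 0 := by
    obtain ⟨R, hR⟩ := hg_supp.isCompact.isBounded.exists_norm_le
    refine ⟨R, fun x hx => image_eq_zero_of_notMem_tsupport fun h => ?_⟩
    exact absurd (hR x h) (not_le.2 hx)
  set A : ℝ := (volume (Set.Icc (-(R + m)) (R + m))).toReal ^ (1 / 2 : ℝ)
  have hA : 0 ≤ A := by positivity
  -- A uniform error `c` on `[-(R + m), R + m]` costs at most `c * A` in `L₂`, which is below `ε /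
  -- 2`.
  set c : ℝ := ε / (2 * (A + 1))
  have hc : 0 < c := by positivity
  obtain ⟨δ, hδ, hgδ⟩ := Metric.uniformContinuous_iff.1
    (hg_supp.uniformContinuous_of_continuous hg_cont) c hc
  obtain ⟨n, hn⟩ := exists_pow_lt_of_lt_one (y := (1 / 2 : ℝ)) (show 0 < δ / (m + 1) by positivity)
    (by norm_num)
  have hs : (1 : ℝ) ≤ 2 ^ (n : ℤ) := by
    rw [zpow_natCast]
    exact one_le_pow₀ one_le_two
  have hms : (m : ℝ) / 2 ^ (n : ℤ) < δ := by
    rw [zpow_natCast, div_eq_mul_inv, ← inv_pow, ← one_div]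
    rw [lt_div_iff₀ (by positivity)] at hn
    have : (0 : ℝ) < (1 / 2) ^ n := by positivity
    nlinarith
  obtain ⟨K, hK⟩ := exists_int_gt ((2 : ℝ) ^ (n : ℤ) * (R + m) + m)
  obtain ⟨h, hh, hhq⟩ := exists_mem_quarkSpace_coeFn m p g n K
  refine ⟨h, Set.mem_iUnion.2 ⟨n, hh⟩, ?_⟩
  rw [← edist_lt_ofReal]
  have h1 : edist f (hg.toLp g) ≤ ENNReal.ofReal (ε / 2) := by
    rw [Lp.edist_def]
    refine le_trans (le_of_eq (eLpNorm_congr_ae ?_)) hfg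
    exact Filter.EventuallyEq.rfl.sub hg.coeFn_toLp
  have h2 : edist (hg.toLp g) h ≤ ENNReal.ofReal c * ENNReal.ofReal A := by
    have hs1 : g.support ⊆ Set.Icc (-(R + m)) (R + m) := fun x hx => abs_le.1 <| by
      by_contra h'
      push Not at h'
      exact hx (hR x (lt_of_le_of_lt (by simp) h'))
    have hs2 : (quasiInterpolant m g ((2 : ℝ) ^ (n : ℤ)) K).support ⊆
        Set.Icc (-(R + m)) (R + m) := fun x hx => abs_le.1 <| by
      by_contra h'
      push Not at h'
      exact hx (quasiInterpolant_eq_zero hs hR K h')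
    have := eLpNorm_sub_le_of_dist_bdd (volume : Measure ℝ) (p := 2) (by simp) measurableSet_Icc
      hc.le (dist_quasiInterpolant_le hm hs hR hc.le (fun x y hxy => by
        rw [← dist_eq_norm]
        exact (hgδ (lt_of_le_of_lt hxy hms)).le) hK.le) hs1 hs2
    rw [Lp.edist_def, eLpNorm_congr_ae (hg.coeFn_toLp.sub hhq)]
    refine this.trans (le_of_eq ?_)
    rw [← ENNReal.ofReal_rpow_of_nonneg (by positivity) (by norm_num),
      ENNReal.ofReal_toReal (by simp)]
    norm_num
  refine lt_of_le_of_lt ((edist_triangle f (hg.toLp g) h).trans (add_le_add h1 h2)) ?_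
  rw [← ENNReal.ofReal_mul hc.le, ← ENNReal.ofReal_add (by positivity) (by positivity),
    ENNReal.ofReal_lt_ofReal_iff hε]
  have : c * A < ε / 2 := by
    rw [div_mul_eq_mul_div, div_lt_iff₀ (by positivity)]
    nlinarith
  linarith

/-! ### Triviality of the intersection -/

theorem memLp_eval_restrict_Ico (P : Polynomial ℂ) (a b : ℝ) :
    MemLp (fun x : ℝ => P.eval (x : ℂ)) 2 (volume.restrict (Set.Ico a b)) := by
  have hP : Continuous fun x : ℝ => P.eval (x : ℂ) := P.continuous.comp Complex.continuous_ofReal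
  obtain ⟨C, hC⟩ := (isCompact_Icc (a := a) (b := b)).exists_bound_of_continuousOn hP.continuousOn
  refine MemLp.of_bound hP.aestronglyMeasurable C ?_
  exact (ae_restrict_iff' measurableSet_Ico).2
    (Filter.Eventually.of_forall fun x hx => hC x (Set.Ico_subset_Icc_self hx))

/-- The functions in `L₂(ℝ)` that agree a.e. on `[a, b)` with a polynomial of degree at most `N`. -/
def polynomialOn (N : ℕ) (a b : ℝ) : Submodule ℂ L2 :=
  (Submodule.span ℂ (Set.range fun i : Fin (N + 1) =>
    (memLp_eval_restrict_Ico (Polynomial.X ^ (i : ℕ)) a b).toLp _)).comap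
    (LpToLpRestrictCLM ℝ ℂ ℂ volume 2 (Set.Ico a b) :
      L2 →ₗ[ℂ] Lp ℂ 2 (volume.restrict (Set.Ico a b)))

/-- The degree bound makes the space of polynomials finite-dimensional, hence closed, and
restriction is continuous. Closedness is what carries polynomiality from the generators to all of
`V_{p,j}`. -/
theorem isClosed_polynomialOn (N : ℕ) (a b : ℝ) : IsClosed (polynomialOn N a b : Set L2) := by
  have := FiniteDimensional.span_of_finite ℂ (Set.finite_range fun i : Fin (N + 1) =>
    (memLp_eval_restrict_Ico (Polynomial.X ^ (i : ℕ)) a b).toLp _)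
  exact (Submodule.closed_of_finiteDimensional (Submodule.span ℂ (Set.range fun i : Fin (N + 1) =>
    (memLp_eval_restrict_Ico (Polynomial.X ^ (i : ℕ)) a b).toLp _))).preimage
    (LpToLpRestrictCLM ℝ ℂ ℂ volume 2 (Set.Ico a b)).continuous

theorem exists_polynomial_of_mem_polynomialOn {N : ℕ} {a b : ℝ} {f : L2}
    (hf : f ∈ polynomialOn N a b) :
    ∃ P : Polynomial ℂ, f =ᵐ[volume.restrict (Set.Ico a b)] fun x => P.eval (x : ℂ) := by
  suffices h : ∀ g ∈ Submodule.span ℂ (Set.range fun i : Fin (N + 1) =>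
      (memLp_eval_restrict_Ico (Polynomial.X ^ (i : ℕ)) a b).toLp _),
      ∃ P : Polynomial ℂ, g =ᵐ[volume.restrict (Set.Ico a b)] fun x => P.eval (x : ℂ) by
    obtain ⟨P, hP⟩ := h _ hf
    exact ⟨P, (LpToLpRestrictCLM_coeFn ℂ (Set.Ico a b) f).symm.trans hP⟩
  intro g hg
  induction hg using Submodule.span_induction with
  | mem x hx =>
    obtain ⟨i, rfl⟩ := hx
    exact ⟨Polynomial.X ^ (i : ℕ), MemLp.coeFn_toLp _⟩
  | zero => exact ⟨0, (Lp.coeFn_zero _ _ _).trans (by simp; rfl)⟩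
  | add f g _ _ hf hg =>
    obtain ⟨P, hP⟩ := hf
    obtain ⟨Q, hQ⟩ := hg
    refine ⟨P + Q, (Lp.coeFn_add f g).trans ((hP.add hQ).trans ?_)⟩
    simp only [Polynomial.eval_add]
    rfl
  | smul c f _ hf =>
    obtain ⟨P, hP⟩ := hf
    refine ⟨c • P, (Lp.coeFn_smul c f).trans ((hP.const_smul c).trans ?_)⟩
    simp only [Polynomial.eval_smul]
    rfl

theorem mem_polynomialOn {N : ℕ} {a b : ℝ} {f : L2} {P : Polynomial ℂ} (hN : P.natDegree ≤ N)
    (hP : f =ᵐ[volume.restrict (Set.Ico a b)] fun x => P.eval (x : ℂ)) :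
    f ∈ polynomialOn N a b := by
  have h : LpToLpRestrictCLM ℝ ℂ ℂ volume 2 (Set.Ico a b) f =
      ∑ i : Fin (N + 1), P.coeff i •
        (memLp_eval_restrict_Ico (Polynomial.X ^ (i : ℕ)) a b).toLp _ := by
    apply Lp.ext
    have h1 : ∀ᵐ x ∂(volume.restrict (Set.Ico a b)), ∀ i : Fin (N + 1),
        (P.coeff i • (memLp_eval_restrict_Ico (Polynomial.X ^ (i : ℕ)) a b).toLp _ :
          Lp ℂ 2 (volume.restrict (Set.Ico a b))) x = P.coeff i * (x : ℂ) ^ (i : ℕ) := by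
      refine ae_all_iff.2 fun i => ?_
      filter_upwards [Lp.coeFn_smul (P.coeff i)
        ((memLp_eval_restrict_Ico (Polynomial.X ^ (i : ℕ)) a b).toLp _),
        (memLp_eval_restrict_Ico (Polynomial.X ^ (i : ℕ)) a b).coeFn_toLp] with x h1 h2
      rw [h1, Pi.smul_apply, h2]
      simp
    filter_upwards [LpToLpRestrictCLM_coeFn ℂ (Set.Ico a b) f, hP, h1,
      Lp.coeFn_fun_finsetSum Finset.univ fun i : Fin (N + 1) => P.coeff i •
        (memLp_eval_restrict_Ico (Polynomial.X ^ (i : ℕ)) a b).toLp _] with x h2 h3 h4 h5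
    rw [h2, h3, h5, Polynomial.eval_eq_sum_range' (Nat.lt_succ_of_le hN),
      ← Fin.sum_univ_eq_sum_range (fun i => P.coeff i * (x : ℂ) ^ i)]
    exact Finset.sum_congr rfl fun i _ => (h4 i).symm
  change LpToLpRestrictCLM ℝ ℂ ℂ volume 2 (Set.Ico a b) f ∈ Submodule.span ℂ _
  rw [h]
  exact Submodule.sum_mem _ fun i _ => Submodule.smul_mem _ _
    (Submodule.subset_span (Set.mem_range_self i))

open Polynomial in
/-- The polynomial that agrees with `φ_q` on `[i, i + 1)`. -/
def quarkPoly (m q : ℕ) (i : ℤ) : ℝ[X] :=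
  (C (⌈(m : ℝ) / 2⌉ : ℝ)⁻¹ * X) ^ q * (splinePoly m (i + ⌊(m : ℝ) / 2⌋)).comp (X - C (i : ℝ))

theorem quark_eq_eval (m q : ℕ) (i : ℤ) {y : ℝ} (hy : y ∈ Set.Ico (i : ℝ) (i + 1)) :
    quark m q y = (quarkPoly m q i).eval y := by
  have := bspline_add_int m (i + ⌊(m : ℝ) / 2⌋) (x := y - i)
    ⟨by linarith [hy.1], by linarith [hy.2]⟩
  rw [quark, quarkPoly]
  simp only [Polynomial.eval_mul, Polynomial.eval_pow, Polynomial.eval_C, Polynomial.eval_X,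
    Polynomial.eval_comp, Polynomial.eval_sub]
  rw [← this]
  congr 2
  · ring
  · push_cast
    ring

theorem natDegree_quarkPoly_le (m q : ℕ) (i : ℤ) : (quarkPoly m q i).natDegree ≤ q + m := by
  refine Polynomial.natDegree_mul_le_of_le ?_ ?_
  · refine (Polynomial.natDegree_pow_le_of_le q ((Polynomial.natDegree_C_mul_le _ _).trans Polynomial.natDegree_X_le)).trans ?_
    omega
  · rw [Polynomial.natDegree_comp, Polynomial.natDegree_X_sub_C, mul_one]
    exact natDegree_splinePoly_le _ _

theorem generator_mem_polynomialOn (m p : ℕ) {q : ℕ} (hq : q ≤ p) (j k l : ℤ) :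
    generator m q j k ∈ polynomialOn (p + m) ((2 : ℝ) ^ (-j) * l) ((2 : ℝ) ^ (-j) * (l + 1)) := by
  have h2 : (0 : ℝ) < 2 ^ j := zpow_pos two_pos j
  set L : Polynomial ℝ := Polynomial.C ((2 : ℝ) ^ j) * Polynomial.X + Polynomial.C (-(k : ℝ))
  refine mem_polynomialOn (P := ((quarkPoly m q (l - k)).comp L).map Complex.ofRealHom) ?_ ?_
  · refine (Polynomial.natDegree_map_le).trans ?_
    rw [Polynomial.natDegree_comp]
    have h3 : L.natDegree ≤ 1 := Polynomial.natDegree_linear_le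
    have h4 := natDegree_quarkPoly_le m q (l - k)
    nlinarith
  · refine (ae_restrict_iff' measurableSet_Ico).2 ?_
    filter_upwards [generator_coeFn m q j k] with x hx hxl
    rw [zpow_neg, ← div_eq_inv_mul, ← div_eq_inv_mul, Set.mem_Ico, div_le_iff₀ h2,
      lt_div_iff₀ h2] at hxl
    rw [hx, quark_eq_eval m q (l - k) ⟨by push_cast; linarith, by push_cast; linarith⟩,
      Polynomial.eval_map, ← Complex.ofRealHom_eq_coe x, Polynomial.eval₂_at_apply,
      Polynomial.eval_comp]
    simp [L, sub_eq_add_neg]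

theorem exists_polynomial_of_mem_quarkSpace {m p : ℕ} {j : ℤ} {f : L2}
    (hf : f ∈ quarkSpace m p j) (l : ℤ) :
    ∃ P : Polynomial ℂ, f =ᵐ[volume.restrict
      (Set.Ico ((2 : ℝ) ^ (-j) * l) ((2 : ℝ) ^ (-j) * (l + 1)))] fun x => P.eval (x : ℂ) :=
  exists_polynomial_of_mem_polynomialOn
    (quarkSpace_le (isClosed_polynomialOn (p + m) _ _)
      (fun _ hq k => generator_mem_polynomialOn m p hq j k l) hf)

theorem polynomial_eq_of_ae_eq {P Q : Polynomial ℂ} {s : Set ℝ} (hs : volume s ≠ 0)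
    (h : (fun x : ℝ => P.eval (x : ℂ)) =ᵐ[volume.restrict s] fun x => Q.eval (x : ℂ)) :
    P = Q := by
  by_contra hne
  have hfin : {x : ℝ | P.eval (x : ℂ) = Q.eval (x : ℂ)}.Finite := by
    refine Set.Finite.subset (((P - Q).roots.toFinset.finite_toSet).preimage
      (Complex.ofReal_injective.injOn)) fun x hx => ?_
    simp [sub_ne_zero.2 hne, sub_eq_zero.2 (show P.eval (x : ℂ) = Q.eval (x : ℂ) from hx)]
  refine hs ?_
  have h0 : volume.restrict s {x : ℝ | P.eval (x : ℂ) = Q.eval (x : ℂ)} = 0 :=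
    hfin.measure_zero _
  have h1 : ∀ᵐ x ∂(volume.restrict s), False := by
    filter_upwards [h, measure_eq_zero_iff_ae_notMem.1 h0] with x hx hx'
    exact hx' hx
  simpa [ae_iff] using h1

/-- A nonzero polynomial is bounded away from zero for large `|x|`, so `|f|` would exceed a positive
constant on a set of infinite measure. -/
theorem ae_eq_zero_of_ae_eq_polynomial {f : L2} {P : Polynomial ℂ} {S : Set ℝ}
    (hS : ∀ X₀ : ℝ, volume (S ∩ {x | X₀ ≤ |x|}) = ⊤) (hSm : MeasurableSet S)
    (h : f =ᵐ[volume.restrict S] fun x => P.eval (x : ℂ)) : f =ᵐ[volume.restrict S] 0 := by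
  by_cases hP : P = 0
  · exact h.trans (by simp [hP]; rfl)
  exfalso
  obtain ⟨X₀, ε, hε, hb⟩ : ∃ X₀ ε : ℝ, 0 < ε ∧ ∀ x : ℝ, X₀ ≤ |x| → ε ≤ ‖P.eval (x : ℂ)‖ := by
    by_cases hd : 0 < P.degree
    · have ht := P.tendsto_norm_atTop hd (l := Filter.comap (fun x : ℝ => |x|) Filter.atTop)
        (z := fun x : ℝ => (x : ℂ)) (by simpa only [Complex.norm_real] using! Filter.tendsto_comap)
      have h1 := ht.eventually (Filter.eventually_ge_atTop 1)
      rw [Filter.eventually_comap, Filter.eventually_atTop] at h1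
      obtain ⟨X₀, hX⟩ := h1
      exact ⟨X₀, 1, one_pos, fun x hx => hX _ hx x rfl⟩
    · have hPC := Polynomial.eq_C_of_degree_le_zero (not_lt.1 hd)
      refine ⟨0, ‖P.coeff 0‖, norm_pos_iff.2 fun h0 => hP ?_, fun x _ => ?_⟩
      · rw [hPC, h0, map_zero]
      · rw [hPC]
        simp
  have hlt := (Lp.memLp f).meas_ge_lt_top (by simp) (by simp) (ε := ⟨ε, hε.le⟩)
    (fun h0 => hε.ne' (congrArg NNReal.toReal h0))
  refine hlt.ne (top_le_iff.1 ?_)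
  rw [← hS X₀]
  refine measure_mono_ae ?_
  filter_upwards [(ae_restrict_iff' hSm).1 h] with x hx hxS
  change (⟨ε, hε.le⟩ : NNReal) ≤ ‖f x‖₊
  rw [hx hxS.1]
  exact hb x hxS.2

/-- Every polynomial is determined by its values on `s 0`, which has positive measure, so a single
one represents `f` on the union. -/
theorem ae_eq_zero_of_ae_eq_polynomials {f : L2} {s : ℕ → Set ℝ} (h0 : volume (s 0) ≠ 0)
    (hs : ∀ n, s 0 ⊆ s n) (hm : ∀ n, MeasurableSet (s n))
    (htop : ∀ X₀ : ℝ, volume ((⋃ n, s n) ∩ {x | X₀ ≤ |x|}) = ⊤)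
    (h : ∀ n, ∃ P : Polynomial ℂ, f =ᵐ[volume.restrict (s n)] fun x => P.eval (x : ℂ)) :
    f =ᵐ[volume.restrict (⋃ n, s n)] 0 := by
  choose P hP using h
  have hPn : ∀ n, P n = P 0 := fun n => polynomial_eq_of_ae_eq h0
    ((ae_restrict_of_ae_restrict_of_subset (hs n) (hP n)).mp
      ((hP 0).mono fun x hx hx' => hx'.symm.trans hx))
  refine ae_eq_zero_of_ae_eq_polynomial htop (MeasurableSet.iUnion hm) (P := P 0) ?_
  rw [Filter.EventuallyEq, ae_restrict_iUnion_iff]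
  intro n
  rw [← hPn n]
  exact hP n

theorem iInter_quarkSpace (m p : ℕ) : (⋂ j, (quarkSpace m p j : Set L2)) = {0} := by
  refine Set.Subset.antisymm (fun f hf => ?_)
    (Set.singleton_subset_iff.2 (Set.mem_iInter.2 fun j => zero_mem _))
  rw [Set.mem_iInter] at hf
  -- The two half-lines are treated separately, since `0` is a breakpoint at every scale. The
  -- intervals below are the cells `l = 0` and `l = -1` at scale `j = -n`.
  have hU : ∀ x : ℝ, ∃ n : ℕ, |x| < 2 ^ n := fun x => pow_unbounded_of_one_lt _ one_lt_two
  have h1 : ∀ n : ℕ, (1 : ℝ) ≤ 2 ^ n := fun n => one_le_pow₀ one_le_two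
  have hpos : f =ᵐ[volume.restrict (⋃ n : ℕ, Set.Ico (0 : ℝ) (2 ^ n))] 0 := by
    refine ae_eq_zero_of_ae_eq_polynomials (by simp)
      (fun n => Set.Ico_subset_Ico_right (by simpa using h1 n)) (fun n => measurableSet_Ico)
      (fun X₀ => top_le_iff.1 ?_) fun n => ?_
    · rw [← Real.volume_Ici (a := max X₀ 0)]
      refine measure_mono fun x hx => ⟨?_, ?_⟩
      · obtain ⟨n, hn⟩ := hU x
        exact Set.mem_iUnion.2 ⟨n, (le_max_right _ _).trans hx, (le_abs_self x).trans_lt hn⟩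
      · exact ((le_max_left _ _).trans hx).trans (le_abs_self x)
    · simpa using exists_polynomial_of_mem_quarkSpace (hf (-(n : ℤ))) 0
  have hneg : f =ᵐ[volume.restrict (⋃ n : ℕ, Set.Ico (-(2 : ℝ) ^ n) 0)] 0 := by
    refine ae_eq_zero_of_ae_eq_polynomials (by simp)
      (fun n => Set.Ico_subset_Ico_left (by simpa using h1 n)) (fun n => measurableSet_Ico)
      (fun X₀ => top_le_iff.1 ?_) fun n => ?_
    · rw [← Real.volume_Iio (a := min (-X₀) 0)]
      refine measure_mono fun x hx => ⟨?_, ?_⟩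
      · obtain ⟨n, hn⟩ := hU x
        exact Set.mem_iUnion.2 ⟨n, by linarith [neg_abs_le x], hx.trans_le (min_le_right _ _)⟩
      · have : x < -X₀ := lt_of_lt_of_le hx (min_le_left _ _)
        change X₀ ≤ |x|
        linarith [neg_le_abs x]
    · simpa using exists_polynomial_of_mem_quarkSpace (hf (-(n : ℤ))) (-1)
  rw [Set.mem_singleton_iff, Lp.eq_zero_iff_ae_eq_zero]
  have huniv : (⋃ n : ℕ, Set.Ico (0 : ℝ) (2 ^ n)) ∪ (⋃ n : ℕ, Set.Ico (-(2 : ℝ) ^ n) 0) =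
      Set.univ := by
    refine Set.eq_univ_of_forall fun x => ?_
    obtain ⟨n, hn⟩ := hU x
    rcases le_or_gt 0 x with hx | hx
    · exact Or.inl (Set.mem_iUnion.2 ⟨n, hx, (le_abs_self x).trans_lt hn⟩)
    · exact Or.inr (Set.mem_iUnion.2 ⟨n, by linarith [neg_abs_le x], hx⟩)
  have hall := (ae_restrict_union_iff _ _ fun x => f x = 0).2 ⟨hpos, hneg⟩
  rwa [huniv, Measure.restrict_univ] at hall

/-! ### Stability from a compactly supported dual -/

section Abstract

variable {E : Type*} [NormedAddCommGroup E]

/-- Expand the square and bound each surviving inner product by half the sum of the two squared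
norms; every index has at most `2 * L + 1` neighbours. -/
theorem norm_sum_sq_le_of_orthogonal_of_far [InnerProductSpace ℂ E] {u : ℤ → E} {L : ℕ}
    (h : ∀ k k' : ℤ, (L : ℤ) ≤ |k - k'| → inner ℂ (u k) (u k') = 0) (S : Finset ℤ) :
    ‖∑ k ∈ S, u k‖ ^ 2 ≤ (2 * L + 1) * ∑ k ∈ S, ‖u k‖ ^ 2 := by
  have h1 : ‖∑ k ∈ S, u k‖ ^ 2 ≤ ∑ k ∈ S, ∑ k' ∈ S,
      ((if |k - k'| < L then ‖u k‖ ^ 2 / 2 else 0) +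
        (if |k' - k| < L then ‖u k'‖ ^ 2 / 2 else 0)) := by
    rw [← inner_self_eq_norm_sq (𝕜 := ℂ), sum_inner, map_sum]
    refine Finset.sum_le_sum fun k _ => ?_
    rw [inner_sum, map_sum]
    refine Finset.sum_le_sum fun k' _ => ?_
    rw [abs_sub_comm k' k]
    split_ifs with hk
    · have := re_inner_le_norm (𝕜 := ℂ) (u k) (u k')
      nlinarith [sq_nonneg (‖u k‖ - ‖u k'‖)]
    · rw [h k k' (not_lt.1 hk)]
      simp
  have h2 : ∀ k, ∑ k' ∈ S, (if |k - k'| < L then ‖u k‖ ^ 2 / 2 else 0) ≤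
      (2 * L + 1) * (‖u k‖ ^ 2 / 2) := by
    intro k
    rw [← Finset.sum_filter, Finset.sum_const, nsmul_eq_mul]
    refine mul_le_mul_of_nonneg_right ?_ (by positivity)
    have hsub : S.filter (fun k' => |k - k'| < L) ⊆ Finset.Icc (k - L) (k + L) := by
      intro k' hk'
      have := abs_lt.1 (Finset.mem_filter.1 hk').2
      rw [Finset.mem_Icc]
      omega
    have := Finset.card_le_card hsub
    rw [Int.card_Icc] at this
    exact_mod_cast this.trans (by omega : (k + L + 1 - (k - L)).toNat ≤ 2 * L + 1)
  refine h1.trans ?_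
  simp only [Finset.sum_add_distrib]
  rw [Finset.sum_comm (f := fun k k' => if |k' - k| < (L : ℤ) then ‖u k'‖ ^ 2 / 2 else 0)]
  have h3 := Finset.sum_le_sum fun k (_ : k ∈ S) => h2 k
  rw [← Finset.mul_sum, ← Finset.sum_div] at h3
  linarith

theorem summable_of_norm_sum_sq_le [CompleteSpace E] {u : ℤ → E} {a : ℤ → ℝ} {C : ℝ} (hC : 0 ≤ C)
    (ha : Summable a) (h : ∀ S : Finset ℤ, ‖∑ k ∈ S, u k‖ ^ 2 ≤ C * ∑ k ∈ S, a k) :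
    Summable u ∧ ‖∑' k, u k‖ ^ 2 ≤ C * ∑' k, a k := by
  have hu : Summable u := by
    refine summable_iff_vanishing_norm.2 fun ε hε => ?_
    -- The denominator is `C + 1` because `C` may be zero.
    obtain ⟨S, hS⟩ := summable_iff_vanishing_norm.1 ha (ε ^ 2 / (C + 1)) (by positivity)
    refine ⟨S, fun t ht => ?_⟩
    have h1 := (le_abs_self _).trans_lt (hS t ht)
    rw [lt_div_iff₀ (by positivity)] at h1
    refine lt_of_pow_lt_pow_left₀ 2 hε.le ?_
    have h2 := h t
    by_cases hs : 0 ≤ ∑ k ∈ t, a k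
    · nlinarith
    · nlinarith [sq_nonneg ‖∑ k ∈ t, u k‖, pow_pos hε 2]
  refine ⟨hu, ?_⟩
  exact le_of_tendsto_of_tendsto' ((hu.hasSum.norm).pow 2) (ha.hasSum.const_mul C) fun S => h S

/-- Bessel's inequality after normalising by `c`. -/
theorem sum_norm_inner_sq_le [InnerProductSpace ℂ E] {e : ℤ → E} {c : ℝ} (hc : 0 < c) (hnorm : ∀ k, ‖e k‖ = c)
    (horth : ∀ k k', k ≠ k' → inner ℂ (e k) (e k') = 0) (x : E) (S : Finset ℤ) :
    ∑ k ∈ S, ‖inner ℂ (e k) x‖ ^ 2 ≤ c ^ 2 * ‖x‖ ^ 2 := by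
  have ho : Orthonormal ℂ fun k => ((c⁻¹ : ℝ) : ℂ) • e k := by
    refine ⟨fun k => ?_, fun k k' hk => ?_⟩
    · rw [norm_smul, hnorm, Complex.norm_real, Real.norm_of_nonneg (by positivity),
        inv_mul_cancel₀ hc.ne']
    · simp only [inner_smul_left, inner_smul_right, horth k k' hk, mul_zero]
  have := ho.sum_inner_products_le x (s := S)
  simp only [inner_smul_left, norm_mul, mul_pow, RCLike.norm_conj, Complex.norm_real,
    Real.norm_of_nonneg (inv_nonneg.2 hc.le), ← Finset.mul_sum] at this
  rwa [inv_pow, inv_mul_le_iff₀ (by positivity)] at this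

end Abstract

theorem inner_eq_zero_of_disjoint {f g : L2} {A B : Set ℝ} (hAB : Disjoint A B)
    (hf : ∀ᵐ x, x ∉ A → f x = 0) (hg : ∀ᵐ x, x ∉ B → g x = 0) : inner ℂ f g = 0 := by
  rw [L2.inner_def]
  refine integral_eq_zero_of_ae ?_
  filter_upwards [hf, hg] with x hfx hgx
  by_cases hx : x ∈ A
  · rw [hgx fun h => Set.disjoint_left.1 hAB hx h]
    simp
  · rw [hfx hx]
    simp

/-- Translation by `b` as a linear isometry of `L₂(ℝ)`. -/
def translateIsometry (b : ℝ) : L2 →ₗᵢ[ℂ] L2 where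
  toLinearMap := affineCLM 1 one_ne_zero b
  norm_map' f := (norm_affineComp 1 one_ne_zero b f).trans (by simp)

theorem translateIsometry_apply (b : ℝ) (f : L2) : translateIsometry b f = translate b f := rfl

theorem translate_coeFn (b : ℝ) (f : L2) : translate b f =ᵐ[volume] fun x => f (x - b) := by
  simpa only [one_mul, translate] using affineComp_coeFn 1 one_ne_zero b f

theorem translate_translate (b b' : ℝ) (f : L2) :
    translate b (translate b' f) = translate (b + b') f :=
  affineComp_affineComp _ _ _ _ _ _ (by simp) (by simp) f

theorem translate_ae_eq_zero {f : L2} {A : Set ℝ} (hf : ∀ᵐ x, x ∉ A → f x = 0) (b : ℝ) :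
    ∀ᵐ x, x ∉ (fun x => x - b) ⁻¹' A → translate b f x = 0 := by
  have h := ae_comp_affine hf one_ne_zero b
  filter_upwards [translate_coeFn b f, h] with x hx hx' hxA
  rw [hx]
  rw [one_mul] at hx'
  exact hx' hxA

/-- Upper bound and convergence: translates of the bounded supports overlap only for nearby indices.
Lower bound: pairing the sum with `g l (· - k)` recovers the coefficient `conj (v k l)`, and the
translates of `g l` are orthogonal because their supports are disjoint, so Bessel's inequality
applies. -/
theorem isL2Stable_of_dual {n : ℕ} {F : Fin n → L2} {M : ℕ}
    (hF : ∀ l, ∀ᵐ x, x ∉ Set.Icc (-(M : ℝ)) M → F l x = 0) {g : Fin n → L2}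
    (hg : ∀ l, ∀ᵐ x, x ∉ Set.Ico (0 : ℝ) 1 → g l x = 0)
    (hdual : ∀ l l' (k : ℤ),
      inner ℂ (g l) (translate (k : ℝ) (F l')) = if k = 0 ∧ l = l' then 1 else 0) :
    IsL2Stable F := by
  -- The summand `1` keeps `A` positive even for `n = 0`. In `B`, supports in `[-M, M]` become
  -- disjoint once shifts differ by `2 * M + 1`.
  set A : ℝ := ∑ l, ‖g l‖ ^ 2 + 1
  set B : ℝ := (2 * (2 * M + 1 : ℕ) + 1) * ∑ l, ‖F l‖ ^ 2
  have hA : 0 < A := by positivity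
  have hB : 0 ≤ B := by positivity
  refine ⟨A⁻¹, max A⁻¹ B, by positivity, le_max_left _ _, fun v hv => ?_⟩
  set w : ℤ → L2 := fun k => ∑ l, conj (v k l) • F l
  have hu : ∀ k : ℤ, ∑ l, conj (v k l) • translate (k : ℝ) (F l) = translate (k : ℝ) (w k) := by
    intro k
    simp only [w, ← translateIsometry_apply, map_sum, map_smul]
  have hw : ∀ k, ∀ᵐ x, x ∉ Set.Icc (-(M : ℝ)) M → w k x = 0 := by
    intro k
    have h1 : ∀ᵐ x, ∀ l, x ∉ Set.Icc (-(M : ℝ)) M → (conj (v k l) • F l : L2) x = 0 := by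
      refine ae_all_iff.2 fun l => ?_
      filter_upwards [hF l, Lp.coeFn_smul (conj (v k l)) (F l)] with x hx hx' hxM
      rw [hx', Pi.smul_apply, hx hxM, smul_zero]
    filter_upwards [h1, Lp.coeFn_fun_finsetSum Finset.univ fun l => conj (v k l) • F l]
      with x hx hx' hxM
    rw [hx']
    exact Finset.sum_eq_zero fun l _ => hx l hxM
  have hwn : ∀ k, ‖w k‖ ^ 2 ≤ (∑ l, ‖F l‖ ^ 2) * ∑ l, ‖v k l‖ ^ 2 := by
    intro k
    have h1 : ‖w k‖ ≤ ∑ l, ‖F l‖ * ‖v k l‖ := by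
      refine norm_sum_le_of_le _ fun l _ => ?_
      rw [norm_smul, RCLike.norm_conj, mul_comm]
    exact (pow_le_pow_left₀ (norm_nonneg _) h1 2).trans (Finset.sum_mul_sq_le_sq_mul_sq _ _ _)
  have hfar : ∀ k k' : ℤ, ((2 * M + 1 : ℕ) : ℤ) ≤ |k - k'| →
      inner ℂ (translate (k : ℝ) (w k)) (translate (k' : ℝ) (w k')) = 0 := by
    intro k k' hk
    refine inner_eq_zero_of_disjoint (Set.disjoint_left.2 fun x hx hx' => ?_)
      (translate_ae_eq_zero (hw k) k) (translate_ae_eq_zero (hw k') k')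
    have h1 : (2 * M + 1 : ℝ) ≤ |(k : ℝ) - k'| := by exact_mod_cast hk
    have h2 : |(k : ℝ) - k'| ≤ 2 * M := by
      rw [abs_le]
      constructor <;> linarith [hx.1, hx.2, hx'.1, hx'.2]
    linarith
  simp only [hu]
  obtain ⟨hs, hle⟩ := summable_of_norm_sum_sq_le (u := fun k : ℤ => translate (k : ℝ) (w k)) hB hv
    fun S => by
      refine (norm_sum_sq_le_of_orthogonal_of_far hfar S).trans ?_
      rw [mul_assoc]
      refine mul_le_mul_of_nonneg_left ?_ (by positivity)
      rw [Finset.mul_sum]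
      refine Finset.sum_le_sum fun k _ => ?_
      rw [← translateIsometry_apply, LinearIsometry.norm_map]
      exact hwn k
  refine ⟨hs, ?_, hle.trans (mul_le_mul_of_nonneg_right (le_max_right _ _)
    (tsum_nonneg fun k => by positivity))⟩
  set h := ∑' k : ℤ, translate (k : ℝ) (w k)
  have hcoef : ∀ (k : ℤ) l, inner ℂ (translate (k : ℝ) (g l)) h = conj (v k l) := by
    intro k l
    have h1 : ∀ k' : ℤ, inner ℂ (translate (k : ℝ) (g l)) (translate (k' : ℝ) (w k')) =
        if k' = k then conj (v k l) else 0 := by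
      intro k'
      -- Factor out the isometric translation by `k`, so that `hdual` applies to the difference `k'
      -- - k`.
      have h2 : translate (k' : ℝ) (w k') = translate (k : ℝ) (translate ((k' - k : ℤ) : ℝ) (w k')) := by
        rw [translate_translate]
        congr 1
        push_cast
        ring
      rw [h2, ← translateIsometry_apply, ← translateIsometry_apply, LinearIsometry.inner_map_map]
      simp only [w, ← translateIsometry_apply, map_sum, map_smul, inner_sum, inner_smul_right]
      simp only [translateIsometry_apply, hdual]
      by_cases hk : k' = k
      · subst hk
        simp
      · simp [hk, sub_eq_zero]
    have h3 := (innerSL ℂ (translate (k : ℝ) (g l))).hasSum hs.hasSum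
    simp only [innerSL_apply_apply, h1] at h3
    exact h3.unique (hasSum_ite_eq k _)
  have hbound : ∀ l (S : Finset ℤ), ∑ k ∈ S, ‖v k l‖ ^ 2 ≤ ‖g l‖ ^ 2 * ‖h‖ ^ 2 := by
    intro l S
    have hgl : g l ≠ 0 := by
      intro h0
      have := hdual l l 0
      simp [h0] at this
    have := sum_norm_inner_sq_le (norm_pos_iff.2 hgl) (e := fun k : ℤ => translate (k : ℝ) (g l))
      (fun k => (translateIsometry (k : ℝ)).norm_map (g l)) (fun k k' hk => ?_) h S
    · simpa only [hcoef, RCLike.norm_conj] using this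
    · refine inner_eq_zero_of_disjoint (Set.disjoint_left.2 fun x hx hx' => hk ?_)
        (translate_ae_eq_zero (hg l) k) (translate_ae_eq_zero (hg l) k')
      have h1 : (k : ℝ) < k' + 1 := by linarith [hx.1, hx'.2]
      have h2 : (k' : ℝ) < k + 1 := by linarith [hx.2, hx'.1]
      have h3 : k < k' + 1 := by exact_mod_cast h1
      have h4 : k' < k + 1 := by exact_mod_cast h2
      omega
  rw [inv_mul_le_iff₀ hA]
  refine hv.tsum_le_of_sum_le fun S => ?_
  rw [Finset.sum_comm]
  refine (Finset.sum_le_sum fun l _ => hbound l S).trans ?_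
  rw [← Finset.sum_mul]
  exact mul_le_mul_of_nonneg_right (by simp [A]) (by positivity)

/-! ### Dual polynomials and the two stable cases -/

theorem polynomial_eq_zero_of_integral_sq_eq_zero {r : Polynomial ℝ}
    (h : ∫ x in (0 : ℝ)..1, r.eval x * r.eval x = 0) : r = 0 := by
  have hc : Continuous fun x : ℝ => r.eval x * r.eval x := r.continuous.mul r.continuous
  have h0 : ∀ x ∈ Set.Icc (0 : ℝ) 1, r.eval x = 0 := by
    intro x hx
    by_contra hne
    refine (intervalIntegral.integral_pos zero_lt_one hc.continuousOn
      (fun y _ => mul_self_nonneg _) ⟨x, hx, mul_self_pos.2 hne⟩).ne' h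
  exact Polynomial.eq_zero_of_infinite_isRoot r
    ((Set.Icc_infinite (zero_lt_one' ℝ)).mono h0)

/-- The Gram matrix of `Q` on `[0, 1]` is injective, since its quadratic form is the integral of the
square of the combination. Hence it is surjective, and preimages of the unit vectors are the
coefficients of the duals. -/
theorem exists_dual_polynomials {ι : Type*} [Fintype ι] [DecidableEq ι] {Q : ι → Polynomial ℝ}
    (hQ : LinearIndependent ℝ Q) : ∃ G : ι → Polynomial ℝ, ∀ i j,
      ∫ x in (0 : ℝ)..1, (G i).eval x * (Q j).eval x = if i = j then 1 else 0 := by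
  have hint : ∀ P R : Polynomial ℝ,
      IntervalIntegrable (fun x => P.eval x * R.eval x) volume 0 1 := fun P R =>
    (P.continuous.mul R.continuous).intervalIntegrable _ _
  let T : Polynomial ℝ →ₗ[ℝ] ι → ℝ :=
    { toFun := fun P j => ∫ x in (0 : ℝ)..1, P.eval x * (Q j).eval x
      map_add' := fun P R => by
        ext j
        simp only [Polynomial.eval_add, add_mul, Pi.add_apply]
        exact intervalIntegral.integral_add (hint _ _) (hint _ _)
      map_smul' := fun c P => by
        ext j
        simp [mul_assoc] }
  let U : (ι → ℝ) →ₗ[ℝ] ι → ℝ := T ∘ₗ Fintype.linearCombination ℝ Q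
  have hU : Function.Injective U := by
    refine (injective_iff_map_eq_zero U).2 fun a ha => ?_
    set r := Fintype.linearCombination ℝ Q a
    have hr : ∑ i, a i • Q i = r := rfl
    have hsum : ∫ x in (0 : ℝ)..1, r.eval x * r.eval x = ∑ j, a j * U a j := by
      have : ∀ x : ℝ, r.eval x * r.eval x = ∑ j, a j * (r.eval x * (Q j).eval x) := by
        intro x
        conv_lhs => enter [1]; rw [← hr, Polynomial.eval_finsetSum]
        rw [Finset.sum_mul]
        refine Finset.sum_congr rfl fun j _ => ?_
        rw [Polynomial.eval_smul, smul_eq_mul]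
        ring
      simp only [this]
      rw [intervalIntegral.integral_finsetSum fun j _ => (hint _ _).const_mul _]
      simp only [intervalIntegral.integral_const_mul]
      rfl
    have hr0 : r = 0 := polynomial_eq_zero_of_integral_sq_eq_zero (by rw [hsum, ha]; simp)
    funext i
    exact Fintype.linearIndependent_iff.1 hQ a (hr.trans hr0) i
  have hs := LinearMap.injective_iff_surjective.1 hU
  choose a ha using fun i => hs (Pi.single i 1)
  refine ⟨fun i => Fintype.linearCombination ℝ Q (a i), fun i j => ?_⟩
  change U (a i) j = _
  rw [ha, Pi.single_apply]
  simp [eq_comm]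

theorem isL2Stable_quarkVector {m p : ℕ} {G : Fin (p + 1) → Polynomial ℝ}
    (hG : ∀ (l l' : Fin (p + 1)) (k : ℤ), ∫ x in (0 : ℝ)..1, (G l).eval x * quark m l' (x - k) =
      if k = 0 ∧ l = l' then 1 else 0) : IsL2Stable (quarkVector m p) := by
  have hmem : ∀ l, MemLp ((Set.Ico (0 : ℝ) 1).indicator fun x => (((G l).eval x : ℝ) : ℂ)) 2 volume := by
    intro l
    rw [memLp_indicator_iff_restrict measurableSet_Ico]
    convert memLp_eval_restrict_Ico ((G l).map Complex.ofRealHom) 0 1 using 2 with x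
    rw [Polynomial.eval_map, ← Complex.ofRealHom_eq_coe x, Polynomial.eval₂_at_apply]
    rfl
  -- The quarks are supported in `[-⌊m/2⌋, m - ⌊m/2⌋]`, which lies in `[-m, m]`.
  refine isL2Stable_of_dual (M := m) (fun l => ?_) (g := fun l => (hmem l).toLp _) (fun l => ?_)
    fun l l' k => ?_
  · filter_upwards [(memLp_quark m l).coeFn_toLp] with x hx hxm
    change quarkL2 m l x = 0
    rw [quarkL2, hx, quark, bspline_eq_zero, mul_zero, Complex.ofReal_zero]
    refine fun h => hxm ?_
    have h1 : (0 : ℝ) ≤ (⌊(m : ℝ) / 2⌋ : ℝ) := by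
      exact_mod_cast Int.floor_nonneg.2 (by positivity)
    have h2 : (⌊(m : ℝ) / 2⌋ : ℝ) ≤ m / 2 := Int.floor_le _
    have h3 : (0 : ℝ) ≤ m := by positivity
    constructor <;> linarith [h.1, h.2]
  · filter_upwards [(hmem l).coeFn_toLp] with x hx hx'
    rw [hx, Set.indicator_of_notMem hx']
  · have h1 : ((if k = 0 ∧ l = l' then 1 else 0 : ℝ) : ℂ) = if k = 0 ∧ l = l' then 1 else 0 := by
      split_ifs <;> simp
    rw [L2.inner_def, ← h1, ← hG l l' k, intervalIntegral.integral_of_le zero_le_one,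
      ← integral_Ico_eq_integral_Ioc, ← integral_complex_ofReal,
      ← integral_indicator measurableSet_Ico]
    refine integral_congr_ae ?_
    have h2 := ae_comp_affine (memLp_quark m l').coeFn_toLp one_ne_zero (k : ℝ)
    filter_upwards [(hmem l).coeFn_toLp, translate_coeFn (k : ℝ) (quarkVector m p l'), h2]
      with x hx hx' hx''
    rw [one_mul] at hx''
    rw [hx, hx']
    change inner ℂ _ (quarkL2 m l' (x - k)) = _
    rw [quarkL2, hx'']
    by_cases h : x ∈ Set.Ico (0 : ℝ) 1
    · simp [Set.indicator_of_mem h, mul_comm]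
    · simp [Set.indicator_of_notMem h]

theorem linearIndependent_splinePoly (n : ℕ) :
    LinearIndependent ℝ fun i : Fin (n + 1) => splinePoly (n + 1) ((i : ℕ) : ℤ) := by
  refine Fintype.linearIndependent_iff.2 fun a ha i => ?_
  have := splinePoly_linearIndependent n (fun i => if h : i < n + 1 then a ⟨i, h⟩ else 0) (by
    rw [← Fin.sum_univ_eq_sum_range
      (fun i : ℕ => (if h : i < n + 1 then a ⟨i, h⟩ else 0) • splinePoly (n + 1) (i : ℤ))]
    simp only [Fin.is_lt, dif_pos, Fin.eta]
    exact ha) i i.2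
  simpa only [Fin.is_lt, dif_pos, Fin.eta] using this

/-- On `[0, 1)` the translate of `φ_0` by `k` is the piece `⌊m/2⌋ - k` of `N_m`, or zero. The dual
of the piece `⌊m/2⌋` therefore detects exactly `k = 0`. -/
theorem isL2Stable_quarkVector_zero {m : ℕ} (hm : 1 ≤ m) : IsL2Stable (quarkVector m 0) := by
  obtain ⟨n, rfl⟩ : ∃ n, m = n + 1 := ⟨m - 1, by omega⟩
  obtain ⟨G, hG⟩ := exists_dual_polynomials (linearIndependent_splinePoly n)
  set d : ℤ := ⌊((n + 1 : ℕ) : ℝ) / 2⌋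
  have hd0 : 0 ≤ d := Int.floor_nonneg.2 (by positivity)
  have hdn : d < (n + 1 : ℕ) := by
    refine Int.floor_lt.2 ?_
    rw [Int.cast_natCast, div_lt_iff₀ two_pos]
    push_cast
    linarith
  lift d to ℕ using hd0 with d' hd'
  refine isL2Stable_quarkVector (G := fun _ => G ⟨d', by omega⟩) fun l l' k => ?_
  obtain rfl : l = l' := (Fin.fin_one_eq_zero l).trans (Fin.fin_one_eq_zero l').symm
  have h1 : ∫ x in (0 : ℝ)..1, (G ⟨d', by omega⟩).eval x * quark (n + 1) l (x - k) =
      ∫ x in (0 : ℝ)..1,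
        (G ⟨d', by omega⟩).eval x * (splinePoly (n + 1) ((d' : ℤ) - k)).eval x := by
    rw [intervalIntegral.integral_of_le zero_le_one, intervalIntegral.integral_of_le zero_le_one,
      ← integral_Ico_eq_integral_Ioc, ← integral_Ico_eq_integral_Ioc]
    refine setIntegral_congr_fun measurableSet_Ico fun x hx => ?_
    rw [← bspline_add_int _ _ hx, Fin.val_eq_zero, quark, pow_zero, one_mul,
      show ⌊((n + 1 : ℕ) : ℝ) / 2⌋ = (d' : ℤ) from hd'.symm]
    congr 2
    push_cast
    ring
  rw [h1]
  by_cases hk : (d' : ℤ) - k < 0 ∨ ((n + 1 : ℕ) : ℤ) ≤ d' - k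
  · rw [splinePoly_eq_zero _ _ hk, if_neg (by omega)]
    simp
  · push Not at hk
    obtain ⟨i, hi⟩ := Int.eq_ofNat_of_zero_le hk.1
    have := hG ⟨d', by omega⟩ ⟨i, by omega⟩
    rw [hi, this]
    simp only [Fin.mk.injEq, and_true]
    congr 1
    simp only [eq_iff_iff]
    omega

/-- For `m = 1` the quarks are the monomials cut off to `[0, 1)`, so only `k = 0` meets the interval
and duals of the monomials suffice. -/
theorem isL2Stable_quarkVector_one (p : ℕ) : IsL2Stable (quarkVector 1 p) := by
  have hli : LinearIndependent ℝ fun i : Fin (p + 1) => (Polynomial.X : Polynomial ℝ) ^ (i : ℕ) := by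
    have := (Polynomial.basisMonomials ℝ).linearIndependent.comp (fun i : Fin (p + 1) => (i : ℕ))
      Fin.val_injective
    simpa [Function.comp_def, Polynomial.monomial_one_right_eq_X_pow] using this
  obtain ⟨G, hG⟩ := exists_dual_polynomials hli
  refine isL2Stable_quarkVector (G := G) fun l l' k => ?_
  have h1 : ∫ x in (0 : ℝ)..1, (G l).eval x * quark 1 l' (x - k) =
      ∫ x in (0 : ℝ)..1, if k = 0 then (G l).eval x * (Polynomial.X ^ (l' : ℕ)).eval x else 0 := by
    rw [intervalIntegral.integral_of_le zero_le_one, intervalIntegral.integral_of_le zero_le_one,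
      ← integral_Ico_eq_integral_Ioc, ← integral_Ico_eq_integral_Ioc]
    refine setIntegral_congr_fun measurableSet_Ico fun x hx => ?_
    have hfloor : ⌊((1 : ℕ) : ℝ) / 2⌋ = 0 := by norm_num
    have hceil : ⌈((1 : ℕ) : ℝ) / 2⌉ = 1 := by norm_num
    have hb : bspline 1 (x - k) = (splinePoly 1 (-k)).eval x := by
      rw [← bspline_add_int _ _ hx, Int.cast_neg, sub_eq_add_neg]
    rw [quark, hfloor, hceil, Int.cast_zero, add_zero, hb]
    by_cases hk : k = 0 <;> simp [splinePoly, hk]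
  rw [h1]
  by_cases hk : k = 0
  · simp only [hk, if_true, true_and]
    exact hG l l'
  · simp [hk]

/-! ### Assembly -/

theorem quarkSpace_zero_eq_shiftSpan (m p : ℕ) :
    quarkSpace m p 0 = shiftSpan (quarkVector m p) := by
  rw [quarkSpace, shiftSpan]
  congr 3
  ext1 i
  rw [Int.cast_zero, zero_div, Real.rpow_zero, Complex.ofReal_one, one_smul]
  exact affineComp_congr _ _ (zpow_zero 2) rfl _

theorem hasMRAProperties_quarkSpace {m : ℕ} (hm : 1 ≤ m) (p : ℕ) :
    HasMRAProperties (quarkSpace m p) where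
  isClosed := isClosed_quarkSpace m p
  nested := quarkSpace_le_succ hm p
  dense := dense_iUnion_quarkSpace hm p
  inter := iInter_quarkSpace m p
  shift := translate_mem_iff m p
  dilation := dilate_mem_iff m p

end Quark

end

theorem theorem3p13 (m p : ℕ) (hm : 1 ≤ m) :
    Quark.HasMRAProperties (Quark.quarkSpace m p) ∧
      ((m = 1 ∨ p = 0) →
        Quark.IsMRA (Quark.quarkSpace m p) ∧
          Quark.IsMultiscalingFunction (Quark.quarkSpace m p) (Quark.quarkVector m p)) := by
  refine ⟨Quark.hasMRAProperties_quarkSpace hm p, fun h => ?_⟩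
  have hG : Quark.IsMultiscalingFunction (Quark.quarkSpace m p) (Quark.quarkVector m p) := by
    refine ⟨?_, Quark.quarkSpace_zero_eq_shiftSpan m p⟩
    rcases h with rfl | rfl
    · exact Quark.isL2Stable_quarkVector_one p
    · exact Quark.isL2Stable_quarkVector_zero hm
  exact ⟨⟨Quark.hasMRAProperties_quarkSpace hm p, p + 1, by omega, _, hG⟩, hG⟩
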